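/- Let $\Sigma=\{0,1\}$ and let $\prec_{\rm lex}$, $\leq_{\rm lex}$ denote "is immediately followed by" and "is at most" in the (length-first) lexicographical order of $\Sigma^*$. An NPTM is a nondeterministic polynomial-time Turing machine; its nondeterminism consists in guessing bits, and each computation path is named by the string of bits guessed along it. $\mathrm{acc}_M(x)$ is the set of (names of) accepting paths of $M$ on input $x$. For a polynomial $p$ with $p(n)\in\mathbb{N}$ for all $n\in\mathbb{N}$, $M$ is $p$-balanced if for every input $x$ the set of guess strings along the computation paths of $M$ on $x$ is precisely $\{0,1\}^{p(|x|)}$. $\mathrm{FP_t}$ is the class of total functions $\Sigma^*\to\Sigma^*$ computable in deterministic polynomial time. A partial function $f$ from $\Sigma^*$ to $\Sigma^*$ is in $\mathrm{UPSV_p}$ if there is an NPTM $M$ that on each input has at most one accepting path, such that $f(x)$ is the output on that path if $M$ has an accepting path on $x$, and $f(x)$ is undefined if $M$ has no accepting path on $x$. $\mathrm{UPSV_t}$ is the class of total functions in $\mathrm{UPSV_p}$. For a class $\mathcal{F}$ of functions $\Sigma^*\to\Sigma^*$, let $\mathrm{CLU\#P}[\mathcal{F}]$ be the class of all total functions $f:\Sigma^*\to\mathbb{N}$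 for which there exist a polynomial $p$ (with $p(n)\in\mathbb{N}$ for all $n\in\mathbb{N}$), a $p$-balanced NPTM $M$, functions $b,\top\in\mathcal{F}$, and a 3-argument polynomial-time computable predicate $\prec$ such that for every $x\in\Sigma^*$ there is a bijection $h_x:\Sigma^{p(|x|)}\to\Sigma^{p(|x|)}$ with: 1. $|b(x)|=|\top(x)|=p(|x|)$; 2. $h_x(b(x))=0^{p(|x|)}$ and $h_x(\top(x))=1^{p(|x|)}$; 3. for all $y,z\in\{0,1\}^{p(|x|)}$: $\prec(x,y,z)\iff h_x(y)\prec_{\rm lex}h_x(z)$; 4. if $f(x)\neq 0$, then there are $\ell,u\in\{0,1\}^{p(|x|)}$ with $\mathrm{acc}_M(x)=\{w\in\{0,1\}^{p(|x|)} : h_x(\ell)\leq_{\rm lex}h_x(w)\leq_{\rm lex}h_x(u)\}$; 5. $f(x)=\|\mathrm{acc}_M(x)\|$. The class $\mathrm{CLU\#P}$ is $\mathrm{CLU\#P}[\mathrm{FP_t}]$. **Corollary.** $\mathrm{CLU\#P}[\mathrm{UPSV_t}]=\mathrm{CLU\#P}$. That is, if in the definition of $\mathrm{CLU\#P}$ the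 bottom and top functions $b,\top$ are taken from $\mathrm{UPSV_t}$ instead of $\mathrm{FP_t}$, the class defined remains precisely $\mathrm{CLU\#P}$. -/

import Mathlib

/-! Strings over `{0,1}` are `List Bool`, with `false` for `0` and `true` for `1`. -/

namespace CLU

/-! ### Strings -/

/-- `Σ^n`, the set of binary strings of length `n`. -/
def strings (n : ℕ) : Set (List Bool) := {w | w.length = n}

/-- `a <_lex b`: the (length-first) lexicographical order of `Σ^*`. -/
def lexLT (a b : List Bool) : Prop := List.Shortlex (· < ·) a b

/-- `a ≤_lex b`. -/
def lexLE (a b : List Bool) : Prop := a = b ∨ lexLT a b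

/-- `a ≺_lex b`: the string `b` is the lexicographical successor of `a`. -/
def lexSucc (a b : List Bool) : Prop :=
  lexLT a b ∧ ∀ c, ¬ (lexLT a c ∧ lexLT c b)

/-- `p : ℕ → ℕ` is a polynomial (its coefficients may be any rational numbers, but its values
on natural numbers are natural numbers). -/
def IsPoly (p : ℕ → ℕ) : Prop :=
  ∃ P : Polynomial ℚ, ∀ n : ℕ, (p n : ℚ) = P.eval (n : ℚ)

/-! ### Nondeterministic multitape Turing machines -/

/-- One move of a machine with tapes `K`, tape alphabet `Γ` and states `Q`: the next state, the
symbol written on each tape, and the direction in which each head then moves (`none`: it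
stays). -/
structure Move (K Γ Q : Type) where
  next : Q
  write : K → Γ
  dir : K → Option Turing.Dir

/-- What a machine does in a given state when it scans given symbols: it halts (accepting or
rejecting), it makes a deterministic move, or it guesses a bit and makes the move
belonging to that bit. -/
inductive Instr (K Γ Q : Type) where
  | halt (accept : Bool)
  | move (m : Move K Γ Q)
  | guess (m : Bool → Move K Γ Q)

/-- A nondeterministic Turing machine with `a` arguments: finitely many two-way infinite tapes,
a finite tape alphabet that contains a blank (`default`) and the two distinct nonblank symbols
`bit false`, `bit true`, finitely many states. The arguments are given on `a` different
tapes. -/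
structure NTM (a : ℕ) where
  K : Type
  Γ : Type
  Q : Type
  finK : Finite K
  finΓ : Finite Γ
  finQ : Finite Q
  blank : Inhabited Γ
  bit : Bool → Γ
  bit_injective : Function.Injective bit
  bit_ne_blank : ∀ b, bit b ≠ default
  input : Fin a ↪ K
  output : K
  start : Q
  instr : Q → (K → Γ) → Instr K Γ Q

namespace NTM

attribute [instance] NTM.blank

variable {a : ℕ}

/-- A configuration: a state and the tapes (each with its head position). -/
structure Cfg (M : NTM a) where
  state : M.Q
  tapes : M.K → Turing.Tape M.Γ

/-- The tape that holds exactly the string `w`, with the head on its first symbol. -/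
def stringTape (M : NTM a) (w : List Bool) : Turing.Tape M.Γ :=
  Turing.Tape.mk₁ (w.map M.bit)

/-- The initial configuration on arguments `v`: all tapes except the input tapes are blank. -/
noncomputable def init (M : NTM a) (v : Fin a → List Bool) : M.Cfg where
  state := M.start
  tapes := Function.extend M.input (fun i => M.stringTape (v i)) (fun _ => default)

/-- The instruction that is due in a configuration. -/
def due (M : NTM a) (c : M.Cfg) : Instr M.K M.Γ M.Q :=
  M.instr c.state (fun k => (c.tapes k).head)

/-- The effect of a move: on each tape, write, then move the head. -/
def apply (M : NTM a) (m : Move M.K M.Γ M.Q) (c : M.Cfg) : M.Cfg where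
  state := m.next
  tapes k :=
    match m.dir k with
    | none => (c.tapes k).write (m.write k)
    | some d => ((c.tapes k).write (m.write k)).move d

/-- `M.Steps c w n c'`: from the configuration `c`, the machine can get to `c'` in exactly `n`
steps, `w` being the sequence of bits guessed on the way. -/
inductive Steps (M : NTM a) : M.Cfg → List Bool → ℕ → M.Cfg → Prop where
  | refl (c : M.Cfg) : Steps M c [] 0 c
  | move {c c' : M.Cfg} {m : Move M.K M.Γ M.Q} {w : List Bool} {n : ℕ} :
      M.due c = Instr.move m → Steps M (M.apply m c) w n c' → Steps M c w (n + 1) c'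
  | guess {c c' : M.Cfg} {m : Bool → Move M.K M.Γ M.Q} {w : List Bool} {n : ℕ} (b : Bool) :
      M.due c = Instr.guess m → Steps M (M.apply (m b) c) w n c' → Steps M c (b :: w) (n + 1) c'

/-- On arguments `v`, the computation path with guesses `w` is complete, halts in the
configuration `c`, and is accepting or rejecting according to `acc`. -/
def Halts (M : NTM a) (v : Fin a → List Bool) (w : List Bool) (c : M.Cfg) (acc : Bool) : Prop :=
  (∃ n, M.Steps (M.init v) w n c) ∧ M.due c = Instr.halt acc

/-- The computation paths of `M` on `v`, each named by its sequence of guesses. -/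
def paths (M : NTM a) (v : Fin a → List Bool) : Set (List Bool) :=
  {w | ∃ c acc, M.Halts v w c acc}

/-- The accepting paths of `M` on `v`, each named by its sequence of guesses. -/
def acc (M : NTM a) (v : Fin a → List Bool) : Set (List Bool) :=
  {w | ∃ c, M.Halts v w c true}

/-- The string `s` is on the output tape in the configuration `c`. -/
def Outputs (M : NTM a) (c : M.Cfg) (s : List Bool) : Prop :=
  c.tapes M.output = M.stringTape s

/-- `M` runs in polynomial time: no computation, whatever is guessed, takes more steps than a
polynomial in the total length of the arguments (so every computation halts). -/
def PolyTime (M : NTM a) : Prop :=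
  ∃ r : Polynomial ℕ, ∀ (v : Fin a → List Bool) (w : List Bool) (n : ℕ) (c : M.Cfg),
    M.Steps (M.init v) w n c → n ≤ r.eval (∑ i, (v i).length)

/-- `M` never guesses. -/
def Deterministic (M : NTM a) : Prop :=
  ∀ q s m, M.instr q s ≠ Instr.guess m

/-- `M` is `p`-balanced: on each input `x`, the sequences of guesses along the computation
paths are precisely the strings of length `p(|x|)`. -/
def Balanced (M : NTM 1) (p : ℕ → ℕ) : Prop :=
  ∀ x : List Bool, M.paths (fun _ => x) = strings (p x.length)

end NTM

/-! ### Complexity classes -/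

/-- `FP_t`: the total functions computed by deterministic polynomial-time Turing machines. -/
def FPt : Set (List Bool → List Bool) :=
  {f | ∃ M : NTM 1, M.Deterministic ∧ M.PolyTime ∧
    ∀ x, ∃ c acc, M.Halts (fun _ => x) [] c acc ∧ M.Outputs c (f x)}

/-- The 3-argument polynomial-time computable predicates. -/
def PTimePred₃ : Set (List Bool → List Bool → List Bool → Prop) :=
  {R | ∃ M : NTM 3, M.Deterministic ∧ M.PolyTime ∧
    ∀ x y z, R x y z ↔ [] ∈ M.acc ![x, y, z]}

/-- `UPSV_p`: the partial functions `f` for which there is a nondeterministic polynomial-time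
Turing machine that has at most one accepting path on each input, that outputs `f x` on that path
if it exists, and that has an accepting path exactly on the domain of `f`. -/
def UPSVp : Set (List Bool →. List Bool) :=
  {f | ∃ M : NTM 1, M.PolyTime ∧ ∀ x,
    (M.acc (fun _ => x)).Subsingleton ∧
    (∀ w c, M.Halts (fun _ => x) w c true → ∃ s ∈ f x, M.Outputs c s) ∧
    (M.acc (fun _ => x) = ∅ → ¬ (f x).Dom)}

/-- `UPSV_t`: the total functions in `UPSV_p`. -/
def UPSVt : Set (List Bool → List Bool) :=
  {f | (f : List Bool →. List Bool) ∈ UPSVp}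

/-- The class of `f : Σ^* → ℕ` defined like `CLU#P`, with bottom and top functions taken from
the class `F`. -/
def CLUSharpPWith (F : Set (List Bool → List Bool)) : Set (List Bool → ℕ) :=
  {f | ∃ p : ℕ → ℕ, IsPoly p ∧
    ∃ M : NTM 1, M.PolyTime ∧ M.Balanced p ∧
    ∃ bot ∈ F, ∃ top ∈ F, ∃ R ∈ PTimePred₃,
    ∀ x : List Bool, ∃ h : List Bool → List Bool,
      Set.BijOn h (strings (p x.length)) (strings (p x.length)) ∧
      ((bot x).length = p x.length ∧ (top x).length = p x.length) ∧
      (h (bot x) = List.replicate (p x.length) false ∧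
        h (top x) = List.replicate (p x.length) true) ∧
      (∀ y ∈ strings (p x.length), ∀ z ∈ strings (p x.length),
        (R x y z ↔ lexSucc (h y) (h z))) ∧
      (f x ≠ 0 → ∃ l ∈ strings (p x.length), ∃ u ∈ strings (p x.length),
        M.acc (fun _ => x) =
          {w | w ∈ strings (p x.length) ∧ lexLE (h l) (h w) ∧ lexLE (h w) (h u)}) ∧
      f x = (M.acc (fun _ => x)).ncard}

/-- The class `CLU#P`. -/
def CLUSharpP : Set (List Bool → ℕ) := CLUSharpPWith FPt

end CLU

set_option linter.unusedSectionVars false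

/-! One inclusion is easy: a deterministic machine made to accept whenever it halts has exactly one
accepting path, so `FPt ⊆ UPSVt` (`fpt_subset_upsvt`) and the classes are monotone in the class of
functions.

For the other (`clu_upsvt_subset`), let `B` and `T` be machines with unique accepting paths that
output `bot x` and `top x`. These values may be hard to find, but they are easy to compute once the
accepting paths `w₁`, `w₂` are given. So the old order on the strings `y` of length `p = p(|x|)` is
hidden inside a larger order with trivial ends. The new strings are `y ++ s` with `|s| = 2 r(|x|)`,
and `s` is the more significant part: there is one block for each `s`. Every block is ordered
lexicographically, except for one special block `s = s₀`, which is ordered by the old bijection `h`.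
Here `s₀` consists of `0…01w₁` and `0…01w₂`, each padded to length `r(|x|)`. As `s₀` is neither
constant zero nor constant one, the first and the last block are ordinary, and the new bottom and
top are simply the strings of zeros and of ones (`twist_replicate`).

Adjacency in the new order is decidable in polynomial time without evaluating `h` (`lexSucc_twist`,
`fpred_insertedSucc`). Inside a block, it is the old predicate or lexicographical adjacency. Between
blocks, the last element of one block meets the first element of the next; for the special block
these are `top x` and `bot x`, and there `s₀` itself supplies the paths on which `T` and `B` output
them. The new machine accepts `y ++ s` iff `s` is special and the old machine accepts on `y`. The
number of accepting paths is unchanged, and an interval of the old order becomes an interval within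
one block (`twist_interval`).

The rest shows that all this is within reach of the given machine model. `FP` collects functions of
several strings computed by deterministic controls over a common alphabet; it is closed under
composition (`FP.comp`) and contains string operations, small automata and polynomials in unary. A
given machine can be simulated along a given guess string (`NTM.reader_runs`), and `exists_balanced`
turns a predicate in `FP` into a balanced machine. The length `p(|x|)` is obtained from the balanced
machine itself (`NTM.fp_guesses`). -/

namespace CLU

open Turing

/-! ### Tapes -/

section Tape

variable {Γ : Type} [Inhabited Γ]

theorem listBlank_mk_default : ListBlank.mk [(default : Γ)] = ListBlank.mk [] := by
  refine ListBlank.ext fun i => ?_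
  rw [ListBlank.nth_mk, ListBlank.nth_mk]
  cases i <;> simp [List.getI]

theorem tape_default : (default : Tape Γ) = Tape.mk₂ [] [] := rfl

@[simp]
theorem mk₂_head_cons (L R : List Γ) (a : Γ) : (Tape.mk₂ L (a :: R)).head = a := rfl

@[simp]
theorem mk₂_move_right (L R : List Γ) (a : Γ) :
    (Tape.mk₂ L (a :: R)).move Dir.right = Tape.mk₂ (a :: L) R := by
  simp [Tape.mk₂]

@[simp]
theorem mk₂_move_left (L R : List Γ) (a : Γ) :
    (Tape.mk₂ (a :: L) R).move Dir.left = Tape.mk₂ L (a :: R) := by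
  simp [Tape.mk₂]

@[simp]
theorem mk₂_move_left_nil (R : List Γ) :
    (Tape.mk₂ [] R).move Dir.left = Tape.mk₂ [] (default :: R) := by
  simp [Tape.mk₂]

@[simp]
theorem mk₂_write_cons (L R : List Γ) (a b : Γ) :
    (Tape.mk₂ L (a :: R)).write b = Tape.mk₂ L (b :: R) := by
  simp [Tape.mk₂]

@[simp]
theorem mk₂_write_nil (L : List Γ) (b : Γ) :
    (Tape.mk₂ L []).write b = Tape.mk₂ L [b] := by
  simp [Tape.mk₂]

/-- A head that runs over the left end of a string and returns leaves a blank behind, which is no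
change of the tape. -/
theorem mk₂_default_left (R : List Γ) : Tape.mk₂ [default] R = Tape.mk₂ [] R := by
  simp [Tape.mk₂, listBlank_mk_default]

@[simp]
theorem write_head (T : Tape Γ) : T.write T.head = T := Tape.write_self T

end Tape

/-- The common tape alphabet: a blank, the two bits, and `N` further symbols. -/
abbrev Sym (N : ℕ) : Type := Option (Bool ⊕ Fin N)

/-- The symbol for a bit. -/
def sbit {N : ℕ} (b : Bool) : Sym N := some (Sum.inl b)

/-- The bit that a symbol stands for, if any. -/
def Sym.toBit {N : ℕ} : Sym N → Option Bool
  | some (Sum.inl b) => some b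
  | _ => none

@[simp]
theorem Sym.toBit_sbit {N : ℕ} (b : Bool) : (sbit b : Sym N).toBit = some b := rfl

@[simp]
theorem Sym.toBit_none {N : ℕ} : Sym.toBit (none : Sym N) = none := rfl

@[simp]
theorem Sym.default_eq_none {N : ℕ} : (default : Sym N) = none := rfl

@[simp]
theorem sbit_ne_none {N : ℕ} (b : Bool) : (sbit b : Sym N) ≠ none := by simp [sbit]

theorem sbit_injective {N : ℕ} : Function.Injective (sbit : Bool → Sym N) := by
  intro a b h; simpa [sbit] using h

/-- The tape whose head has just passed `L` (nearest symbol first) and stands before `R`. -/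
def btape {N : ℕ} (L R : List Bool) : Tape (Sym N) := Tape.mk₂ (L.map sbit) (R.map sbit)

/-- The tape that holds exactly `w`, with the head on its first symbol. -/
abbrev str {N : ℕ} (w : List Bool) : Tape (Sym N) := btape [] w

@[simp]
theorem btape_head_cons {N : ℕ} (L R : List Bool) (b : Bool) :
    (btape L (b :: R) : Tape (Sym N)).head = sbit b := rfl

@[simp]
theorem btape_head_nil {N : ℕ} (L : List Bool) : (btape L [] : Tape (Sym N)).head = none := rfl

@[simp]
theorem btape_move_right {N : ℕ} (L R : List Bool) (b : Bool) :
    (btape L (b :: R) : Tape (Sym N)).move Dir.right = btape (b :: L) R := by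
  simp [btape]

@[simp]
theorem btape_move_left {N : ℕ} (L R : List Bool) (b : Bool) :
    (btape (b :: L) R : Tape (Sym N)).move Dir.left = btape L (b :: R) := by
  simp [btape]

@[simp]
theorem btape_write_cons {N : ℕ} (L R : List Bool) (a b : Bool) :
    (btape L (a :: R) : Tape (Sym N)).write (sbit b) = btape L (b :: R) := by
  simp [btape]

@[simp]
theorem btape_write_nil {N : ℕ} (L : List Bool) (b : Bool) :
    (btape L [] : Tape (Sym N)).write (sbit b) = btape L [b] := by
  simp [btape]

@[simp]
theorem default_eq_str {N : ℕ} : (default : Tape (Sym N)) = btape [] [] := rfl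

/-! ### Finite controls -/

section Core

variable {K Γ Q Q' : Type}

/-- Change the state names of a move. -/
def Move.mapState (f : Q → Q') (m : Move K Γ Q) : Move K Γ Q' := ⟨f m.next, m.write, m.dir⟩

/-- The effect of a move on the tapes. -/
def Move.act [Inhabited Γ] (m : Move K Γ Q) (T : K → Tape Γ) : K → Tape Γ := fun k =>
  match m.dir k with
  | none => (T k).write (m.write k)
  | some d => ((T k).write (m.write k)).move d

/-- Change the state names of an instruction, replacing halting by other instructions. -/
def Instr.elim (onHalt : Bool → Instr K Γ Q') (f : Q → Q') : Instr K Γ Q → Instr K Γ Q'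
  | halt b => onHalt b
  | move m => move (m.mapState f)
  | guess m => guess fun b => (m b).mapState f

/-- A finite control for tapes `K` with alphabet `Γ`; it halts with one of two results. -/
structure Core (K Γ : Type) where
  Q : Type
  finQ : Finite Q
  start : Q
  instr : Q → (K → Γ) → Instr K Γ Q

namespace Core

variable [Inhabited Γ]

/-- `C.Runs q T w n T' b`: started in state `q` on tapes `T`, with guesses `w`, the control halts
after `n` steps with tapes `T'` and result `b`. -/
inductive Runs (C : Core K Γ) :
    C.Q → (K → Tape Γ) → List Bool → ℕ → (K → Tape Γ) → Bool → Prop where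
  | halt {q : C.Q} {T : K → Tape Γ} {b : Bool} :
      C.instr q (fun k => (T k).head) = Instr.halt b → Runs C q T [] 0 T b
  | move {q : C.Q} {T T' : K → Tape Γ} {m : Move K Γ C.Q} {w : List Bool} {n : ℕ} {b : Bool} :
      C.instr q (fun k => (T k).head) = Instr.move m → Runs C m.next (m.act T) w n T' b →
      Runs C q T w (n + 1) T' b
  | guess {q : C.Q} {T T' : K → Tape Γ} {m : Bool → Move K Γ C.Q} {w : List Bool} {n : ℕ}
      {b : Bool} (g : Bool) :
      C.instr q (fun k => (T k).head) = Instr.guess m →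
      Runs C (m g).next ((m g).act T) w n T' b → Runs C q T (g :: w) (n + 1) T' b

/-- The control never guesses. -/
def Det (C : Core K Γ) : Prop := ∀ q s m, C.instr q s ≠ Instr.guess m

/-- First run `C`, then, according to its result, `D true` or `D false`. -/
def bind (C : Core K Γ) (D : Bool → Core K Γ) : Core K Γ where
  Q := C.Q ⊕ (Σ b, (D b).Q)
  finQ := by
    have := C.finQ
    have := fun b => (D b).finQ
    infer_instance
  start := Sum.inl C.start
  instr
    | Sum.inl q, s => (C.instr q s).elim
        (fun b => ((D b).instr (D b).start s).elim Instr.halt fun q => Sum.inr ⟨b, q⟩) Sum.inl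
    | Sum.inr ⟨b, q⟩, s => ((D b).instr q s).elim Instr.halt fun q => Sum.inr ⟨b, q⟩

theorem Det.bind {C : Core K Γ} {D : Bool → Core K Γ} (hC : C.Det) (hD : ∀ b, (D b).Det) :
    (C.bind D).Det := by
  rintro (q | ⟨b, q⟩) s m h
  · rcases h' : C.instr q s with b | _ | m'
    · rcases h'' : (D b).instr (D b).start s with _ | _ | m'
      · simp [Core.bind, h', h'', Instr.elim] at h
      · simp [Core.bind, h', h'', Instr.elim] at h
      · exact hD b _ _ _ h''
    · simp [Core.bind, h', Instr.elim] at h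
    · exact hC _ _ _ h'
  · rcases h'' : (D b).instr q s with _ | _ | m'
    · simp [Core.bind, h'', Instr.elim] at h
    · simp [Core.bind, h'', Instr.elim] at h
    · exact hD b _ _ _ h''

theorem Runs.bind_right {C : Core K Γ} {D : Bool → Core K Γ} {b : Bool} {q : (D b).Q}
    {T T' : K → Tape Γ} {w : List Bool} {n : ℕ} {c : Bool} (h : (D b).Runs q T w n T' c) :
    (C.bind D).Runs (Sum.inr ⟨b, q⟩) T w n T' c := by
  induction h with
  | halt h => exact .halt (by simp [Core.bind, h, Instr.elim])
  | @move q T T' m w n b h _ ih =>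
    refine Runs.move (C := C.bind D) (m := m.mapState fun q => Sum.inr ⟨_, q⟩) ?_ ih
    simp [Core.bind, h, Instr.elim]
  | @guess q T T' m w n b g h _ ih =>
    refine Runs.guess (C := C.bind D) (m := fun g => (m g).mapState fun q => Sum.inr ⟨_, q⟩) g ?_ ih
    simp [Core.bind, h, Instr.elim]

/-- The hand-over costs no step: where `C` would halt, the combined control already executes the
first instruction of `D b`. Hence the step counts add up exactly. -/
theorem Runs.bind {C : Core K Γ} {D : Bool → Core K Γ} {q : C.Q} {T T' T'' : K → Tape Γ}
    {w w' : List Bool} {n n' : ℕ} {b c : Bool} (h : C.Runs q T w n T' b)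
    (h' : (D b).Runs (D b).start T' w' n' T'' c) :
    (C.bind D).Runs (Sum.inl q) T (w ++ w') (n + n') T'' c := by
  induction h with
  | halt h =>
    rw [List.nil_append, zero_add]
    cases h' with
    | halt h' => exact .halt (by simp [Core.bind, h, h', Instr.elim])
    | @move _ _ _ m _ _ _ h' r =>
      refine Runs.move (C := C.bind D) (m := m.mapState fun q => Sum.inr ⟨_, q⟩) ?_
        (Runs.bind_right r)
      simp [Core.bind, h, h', Instr.elim]
    | @guess _ _ _ m _ _ _ g h' r =>
      refine Runs.guess (C := C.bind D) (m := fun g => (m g).mapState fun q => Sum.inr ⟨_, q⟩) g ?_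
        (Runs.bind_right r)
      simp [Core.bind, h, h', Instr.elim]
  | @move _ _ _ m _ _ _ h _ ih =>
    rw [add_right_comm]
    refine Runs.move (C := C.bind D) (m := m.mapState Sum.inl) ?_ (ih h')
    simp [Core.bind, h, Instr.elim]
  | @guess _ _ _ m _ _ _ g h _ ih =>
    rw [add_right_comm]
    refine Runs.guess (C := C.bind D) (m := fun g => (m g).mapState Sum.inl) g ?_ (ih h')
    simp [Core.bind, h, Instr.elim]

/-! ### Sequences of controls -/

/-- The control that halts at once with result `b`. -/
def done (b : Bool) : Core K Γ := ⟨Unit, inferInstance, (), fun _ _ => Instr.halt b⟩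

theorem done_det (b : Bool) : (done b : Core K Γ).Det := by
  intro q s m h; simp [done] at h

theorem done_runs (b : Bool) (T : K → Tape Γ) : (done b).Runs (done b).start T [] 0 T b :=
  .halt rfl

/-- Run finitely many controls one after the other. -/
def seq : List (Core K Γ) → Core K Γ
  | [] => done true
  | C :: l => C.bind fun _ => seq l

theorem seq_det : ∀ {l : List (Core K Γ)}, (∀ C ∈ l, C.Det) → (seq l).Det
  | [], _ => done_det _
  | _ :: _, h => Det.bind (h _ List.mem_cons_self) fun _ =>
      seq_det fun C hC => h C (List.mem_cons_of_mem _ hC)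

/-- A loop rule: the invariant `P` depends on the set of indices already treated, not on their
order, so any enumeration without repetition will do. -/
theorem seq_runs {ι : Type} (C : ι → Core K Γ) (P : Set ι → (K → Tape Γ) → Prop) (t : ℕ)
    (h : ∀ i s T, i ∉ s → P s T →
      ∃ n ≤ t, ∃ T' b, (C i).Runs (C i).start T [] n T' b ∧ P (insert i s) T') :
    ∀ (l : List ι) (s : Set ι) (T : K → Tape Γ), l.Nodup → (∀ i ∈ l, i ∉ s) → P s T →
      ∃ n ≤ l.length * t, ∃ T' b, (seq (l.map C)).Runs (seq (l.map C)).start T [] n T' b ∧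
        P (s ∪ {i | i ∈ l}) T'
  | [], s, T, _, _, hP => ⟨0, by simp, T, true, done_runs _ _, by simpa using hP⟩
  | i :: l, s, T, hl, hs, hP => by
    obtain ⟨n, hn, T', b, hr, hP'⟩ := h i s T (hs i List.mem_cons_self) hP
    rw [List.nodup_cons] at hl
    obtain ⟨n', hn', T'', b', hr', hP''⟩ := seq_runs C P t h l (insert i s) T' hl.2 (by
      intro j hj hj'
      rcases hj' with rfl | hj'
      · exact hl.1 hj
      · exact hs j (List.mem_cons_of_mem _ hj) hj') hP'
    refine ⟨n + n', ?_, T'', b', Runs.bind hr hr', ?_⟩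
    · rw [List.length_cons, add_mul, one_mul]; omega
    · convert hP'' using 1
      ext j
      simp only [Set.mem_union, Set.mem_ofPred_eq, List.mem_cons, Set.mem_insert_iff]
      tauto

theorem seq_runs_univ {ι : Type} [Fintype ι] (C : ι → Core K Γ)
    (P : Set ι → (K → Tape Γ) → Prop) (t : ℕ)
    (h : ∀ i s T, i ∉ s → P s T →
      ∃ n ≤ t, ∃ T' b, (C i).Runs (C i).start T [] n T' b ∧ P (insert i s) T')
    (T : K → Tape Γ) (hP : P ∅ T) :
    ∃ n ≤ Fintype.card ι * t, ∃ T' b, (seq (Finset.univ.toList.map C)).Runs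
      (seq (Finset.univ.toList.map C)).start T [] n T' b ∧ P Set.univ T' := by
  obtain ⟨n, hn, T', b, hr, hP'⟩ := seq_runs C P t h Finset.univ.toList ∅ T
    (Finset.nodup_toList _) (by simp) hP
  refine ⟨n, by simpa using hn, T', b, hr, ?_⟩
  convert hP'
  ext; simp

/-! ### Controls that work on some of the tapes -/

/-- Let a move take place on some of the tapes, leaving the symbols `s` on the others alone. -/
noncomputable def _root_.CLU.Move.embed {K₁ : Type} (e : K₁ ↪ K) (s : K → Γ) (m : Move K₁ Γ Q) :
    Move K Γ Q :=
  ⟨m.next, Function.extend e m.write s, Function.extend e m.dir fun _ => none⟩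

/-- Let a control work on some of the tapes, leaving the others alone. -/
noncomputable def embed {K₁ : Type} (C : Core K₁ Γ) (e : K₁ ↪ K) : Core K Γ where
  Q := C.Q
  finQ := C.finQ
  start := C.start
  instr q s :=
    match C.instr q (fun k => s (e k)) with
    | .halt b => .halt b
    | .move m => .move (m.embed e s)
    | .guess m => .guess fun b => (m b).embed e s

theorem Det.embed {K₁ : Type} {C : Core K₁ Γ} (hC : C.Det) (e : K₁ ↪ K) : (C.embed e).Det := by
  intro q s m h
  rcases h' : C.instr q (fun k => s (e k)) with b | _ | m'
  · simp [Core.embed, h'] at h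
  · simp [Core.embed, h'] at h
  · exact hC _ _ _ h'

/-- Every move writes on every tape; outside the range of `e` the scanned symbol is rewritten and
the head stays, so nothing changes there. -/
theorem act_embed {K₁ : Type} (e : K₁ ↪ K) (m : Move K₁ Γ Q) (T₁ : K₁ → Tape Γ)
    (T : K → Tape Γ) :
    (m.embed e fun k => (Function.extend e T₁ T k).head).act (Function.extend e T₁ T) =
      Function.extend e (m.act T₁) T := by
  funext k
  by_cases hk : ∃ j, e j = k
  · obtain ⟨j, rfl⟩ := hk
    simp [Move.embed, Move.act, e.injective.extend_apply]
  · simp [Move.embed, Move.act, Function.extend_apply' _ _ _ hk]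

theorem Runs.embed {K₁ : Type} {C : Core K₁ Γ} (e : K₁ ↪ K) {q : C.Q} {T₁ T₁' : K₁ → Tape Γ}
    {w : List Bool} {n : ℕ} {b : Bool} (h : C.Runs q T₁ w n T₁' b) (T : K → Tape Γ) :
    (C.embed e).Runs q (Function.extend e T₁ T) w n (Function.extend e T₁' T) b := by
  induction h with
  | halt h => exact .halt (by simp [Core.embed, e.injective.extend_apply, h])
  | @move q T₁ _ m _ _ _ h _ ih =>
    rw [← act_embed] at ih
    refine Runs.move (C := C.embed e)
      (m := m.embed e fun k => (Function.extend e T₁ T k).head) ?_ ih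
    simp only [Core.embed, e.injective.extend_apply, h]
  | @guess q T₁ _ m _ _ _ g h _ ih =>
    rw [← act_embed] at ih
    refine Runs.guess (C := C.embed e)
      (m := fun g => (m g).embed e fun k => (Function.extend e T₁ T k).head) g ?_ ih
    simp only [Core.embed, e.injective.extend_apply, h]

/-- A form of `Runs.embed` in which the initial tapes need not be presented as an extension. -/
theorem Runs.embed' {K₁ : Type} {C : Core K₁ Γ} (e : K₁ ↪ K) {q : C.Q} {T₁ T₁' : K₁ → Tape Γ}
    {w : List Bool} {n : ℕ} {b : Bool} (h : C.Runs q T₁ w n T₁' b) (T : K → Tape Γ)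
    (hT : ∀ k, T (e k) = T₁ k) :
    (C.embed e).Runs q T w n (Function.extend e T₁' T) b := by
  have : Function.extend e T₁ T = T := by
    funext k
    by_cases hk : ∃ j, e j = k
    · obtain ⟨j, rfl⟩ := hk
      rw [e.injective.extend_apply, hT]
    · rw [Function.extend_apply' _ _ _ hk]
  simpa only [this] using h.embed e T

end Core

end Core

end CLU

namespace CLU

open Turing

/-! ### Elementary controls -/

namespace Core

variable {K : Type} {N : ℕ}

open Classical in
/-- Move the heads of the tapes in `S` by one cell. -/
noncomputable def shift {Q : Type} (S : Set K) (d : Dir) (q : Q) (s : K → Sym N) :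
    Move K (Sym N) Q :=
  ⟨q, s, fun k => if k ∈ S then some d else none⟩

open Classical in
theorem act_shift {Q : Type} (S : Set K) (d : Dir) (q : Q) (T : K → Tape (Sym N)) :
    (shift S d q fun k => (T k).head).act T = fun k => if k ∈ S then (T k).move d else T k := by
  funext k
  by_cases hk : k ∈ S <;> simp [shift, Move.act, hk]

open Classical in
theorem Runs.shift {C : Core K (Sym N)} {S : Set K} {d : Dir} {q q' : C.Q}
    {T T' : K → Tape (Sym N)} {w : List Bool} {n : ℕ} {b : Bool}
    (h : C.instr q (fun k => (T k).head) = .move (shift S d q' fun k => (T k).head))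
    (hr : C.Runs q' (fun k => if k ∈ S then (T k).move d else T k) w n T' b) :
    C.Runs q T w (n + 1) T' b :=
  .move h (by rw [act_shift]; exact hr)

/-- Move the heads of the tapes in `S` back to the first symbol on the tape `a`. -/
noncomputable def rewind (a : K) (S : Set K) : Core K (Sym N) where
  Q := Fin 3
  finQ := inferInstance
  start := 0
  instr
    | 0, s => .move (shift S Dir.left 1 s)
    | 1, s => if s a = none then .move (shift S Dir.right 2 s) else .move (shift S Dir.left 1 s)
    | 2, _ => .halt true

theorem rewind_det (a : K) (S : Set K) : (rewind a S : Core K (Sym N)).Det := by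
  intro q s m h
  change Fin 3 at q
  fin_cases q
  · simp [rewind] at h
  · by_cases hs : s a = none <;> simp [rewind, hs] at h
  · simp [rewind] at h

open Classical in
-- All tapes in `S` have the same contents, so scanning `a` alone suffices. The heads start one cell
-- left of the boundary of `L` and `R`, walk left until they scan a blank, and step right once.
theorem rewind_back {a : K} {S : Set K} (ha : a ∈ S) :
    ∀ (L R : List Bool) (T : K → Tape (Sym N)),
      (∀ k ∈ S, T k = (btape L R).move Dir.left) →
      (rewind a S).Runs (1 : Fin 3) T [] (L.length + 1)
        (fun k => if k ∈ S then str (L.reverse ++ R) else T k) true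
  | [], R, T, hT => by
    have hs : (T a).head = none := by rw [hT a ha]; simp [btape]
    refine Runs.shift (C := rewind a S) (q' := (2 : Fin 3)) (if_pos hs) ?_
    have hT' : (fun k => if k ∈ S then (T k).move Dir.right else T k) =
        fun k => if k ∈ S then str R else T k := by
      funext k
      by_cases hk : k ∈ S
      · simp only [hk, if_true, hT k hk]
        simp only [btape, List.map_nil, mk₂_move_left_nil, mk₂_move_right, mk₂_default_left]
      · simp [hk]
    rw [hT']
    exact Runs.halt rfl
  | c :: L, R, T, hT => by
    have hs : (T a).head ≠ none := by rw [hT a ha]; simp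
    refine Runs.shift (C := rewind a S) (q' := (1 : Fin 3)) (if_neg hs) ?_
    have := rewind_back ha L (c :: R) (fun k => if k ∈ S then (T k).move Dir.left else T k)
      (fun k hk => by simp [hk, hT k hk])
    convert this using 1
    · rfl
    · funext k
      by_cases hk : k ∈ S <;> simp [hk]

open Classical in
theorem rewind_runs {a : K} {S : Set K} (ha : a ∈ S) (L : List Bool) (T : K → Tape (Sym N))
    (hT : ∀ k ∈ S, T k = btape L []) :
    (rewind a S).Runs (rewind a S : Core K (Sym N)).start T [] (L.length + 2)
      (fun k => if k ∈ S then str L.reverse else T k) true := by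
  refine Runs.shift (C := rewind a S) (q' := (1 : Fin 3)) rfl ?_
  have := rewind_back ha L [] (fun k => if k ∈ S then (T k).move Dir.left else T k)
    (fun k hk => by simp [hk, hT k hk])
  convert this using 1
  funext k
  by_cases hk : k ∈ S <;> simp [hk]

open Classical in
/-- Move to the end of the tape `a`, writing its symbols on the tapes in `S`. -/
noncomputable def spread (a : K) (S : Set K) : Core K (Sym N) where
  Q := Unit
  finQ := inferInstance
  start := ()
  instr _ s := if s a = none then .halt true else
    .move ⟨(), fun k => if k ∈ S then s a else s k,
      fun k => if k ∈ insert a S then some Dir.right else none⟩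

theorem spread_det (a : K) (S : Set K) : (spread a S : Core K (Sym N)).Det := by
  intro q s m h
  by_cases hs : s a = none <;> simp [spread, hs] at h

open Classical in
theorem spread_runs {a : K} {S : Set K} (ha : a ∉ S) :
    ∀ (R L : List Bool) (T : K → Tape (Sym N)), T a = btape L R → (∀ k ∈ S, T k = btape L []) →
      (spread a S).Runs () T [] R.length
        (fun k => if k ∈ insert a S then btape (R.reverse ++ L) [] else T k) true
  | [], L, T, hTa, hT => by
    have hT' : (fun k => if k ∈ insert a S then btape ([].reverse ++ L) [] else T k) = T := by
      funext k
      by_cases hk : k ∈ S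
      · simp [hk, hT k hk]
      · by_cases hka : k = a
        · subst hka; simp [hTa]
        · simp [hk, hka]
    rw [hT']
    exact Runs.halt (if_pos (by simp [hTa]))
  | c :: R, L, T, hTa, hT => by
    have hs : (T a).head ≠ none := by rw [hTa]; simp
    refine Runs.move (C := spread a S) (if_neg hs) ?_
    convert spread_runs ha R (c :: L) _ _ _ using 1
    · funext k
      by_cases hk : k ∈ insert a S
      · simp [hk]
      · have h1 : k ∉ S := fun h => hk (Or.inr h)
        simp only [if_neg hk, Move.act, h1, if_false, write_head]
    · simp [Move.act, ha, hTa]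
    · intro k hk
      simp [Move.act, hk, hTa, hT k hk]

/-- Copy the string on the tape `a` to the blank tapes in `S`. -/
noncomputable def copy (a : K) (S : Set K) : Core K (Sym N) :=
  (spread a S).bind fun _ => rewind a (insert a S)

theorem copy_det (a : K) (S : Set K) : (copy a S : Core K (Sym N)).Det :=
  (spread_det a S).bind fun _ => rewind_det a _

open Classical in
theorem copy_runs {a : K} {S : Set K} (ha : a ∉ S) (w : List Bool) (T : K → Tape (Sym N))
    (hTa : T a = str w) (hT : ∀ k ∈ S, T k = default) :
    (copy a S).Runs (copy a S : Core K (Sym N)).start T [] (2 * w.length + 2)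
      (fun k => if k ∈ S then str w else T k) true := by
  have h1 := spread_runs ha w [] T hTa hT
  have h2 := rewind_runs (Set.mem_insert a S) w.reverse
    (fun k => if k ∈ insert a S then btape (w.reverse ++ []) [] else T k)
    (fun k hk => by simp [hk])
  have hT' : (fun k => if k ∈ S then str w else T k) = fun k =>
      if k ∈ insert a S then str w.reverse.reverse
      else if k ∈ insert a S then btape (w.reverse ++ []) [] else T k := by
    funext k
    by_cases hk : k ∈ S
    · simp [hk]
    · by_cases hka : k = a
      · subst hka; simp [hTa, hk]
      · simp [hk, hka]
  rw [hT', show 2 * w.length + 2 = w.length + (w.reverse.length + 2) by simp; ring]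
  refine Runs.bind (D := fun _ => rewind a (insert a S)) h1 ?_
  convert h2

end Core

/-! ### Polynomial-time computable functions of several strings -/

/-- The total length of a tuple of strings. -/
def size {k : ℕ} (v : Fin k → List Bool) : ℕ := ∑ i, (v i).length

theorem length_le_size {k : ℕ} (v : Fin k → List Bool) (i : Fin k) : (v i).length ≤ size v :=
  Finset.single_le_sum (f := fun i => (v i).length) (fun _ _ => Nat.zero_le _) (Finset.mem_univ i)

/-- The tapes that hold the strings `v` on the input tapes and nothing else. -/
noncomputable def initTapes {K : Type} {N k : ℕ} (inp : Fin k ↪ K) (v : Fin k → List Bool) :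
    K → Tape (Sym N) :=
  Function.extend inp (fun i => str (v i)) fun _ => default

@[simp]
theorem initTapes_inp {K : Type} {N k : ℕ} (inp : Fin k ↪ K) (v : Fin k → List Bool) (i : Fin k) :
    (initTapes inp v (inp i) : Tape (Sym N)) = str (v i) :=
  inp.injective.extend_apply _ _ _

theorem initTapes_of_ne {K : Type} {N k : ℕ} (inp : Fin k ↪ K) (v : Fin k → List Bool) {κ : K}
    (h : ∀ i, inp i ≠ κ) : (initTapes inp v κ : Tape (Sym N)) = default :=
  Function.extend_apply' _ _ _ fun ⟨i, hi⟩ => h i hi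

/-- `f` is computed in polynomial time, whatever the number of additional tape symbols (provided
that it is large enough). -/
def FP {k : ℕ} (f : (Fin k → List Bool) → List Bool) : Prop :=
  ∃ r : Polynomial ℕ, (∀ v, (f v).length ≤ r.eval (size v)) ∧
    ∃ N₀, ∀ N ≥ N₀, ∃ (K : Type) (_ : Finite K) (C : Core K (Sym N)) (inp : Fin k ↪ K) (out : K),
      C.Det ∧ ∀ v, ∃ n ≤ r.eval (size v), ∃ T b,
        C.Runs C.start (initTapes inp v) [] n T b ∧ T out = str (f v)

theorem eval_mono (r : Polynomial ℕ) : Monotone fun n => r.eval n := by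
  intro m n h
  simp only [Polynomial.eval_eq_sum, Polynomial.sum]
  exact Finset.sum_le_sum fun i _ => Nat.mul_le_mul_left _ (Nat.pow_le_pow_left h i)

/-! ### Transducers -/

/-- A control that reads several tapes and writes symbols one after the other on another one. -/
structure Trans (k : ℕ) where
  S : Type
  finS : Finite S
  start : S
  next : S → (Fin k → Option Bool) → Option (S × (Fin k → Option Dir) × Option Bool)

namespace Trans

variable {k N : ℕ}

/-- Move the heads of the tapes. -/
def step (d : Fin k → Option Dir) (T : Fin k → Tape (Sym N)) : Fin k → Tape (Sym N) := fun i =>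
  match d i with
  | none => T i
  | some d => (T i).move d

/-- `A.Runs s T out n`: from state `s`, reading tapes `T`, the transducer stops after `n` steps and
writes `out`. -/
inductive Runs (A : Trans k) : A.S → (Fin k → Tape (Sym N)) → List Bool → ℕ → Prop where
  | quit {s : A.S} {T : Fin k → Tape (Sym N)} :
      A.next s (fun i => (T i).head.toBit) = none → Runs A s T [] 0
  | step {s s' : A.S} {T : Fin k → Tape (Sym N)} {d : Fin k → Option Dir} {e : Option Bool}
      {out : List Bool} {n : ℕ} :
      A.next s (fun i => (T i).head.toBit) = some (s', d, e) → Runs A s' (step d T) out n →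
      Runs A s T (e.toList ++ out) (n + 1)

/-- The control that works like a transducer. -/
def core (A : Trans k) : Core (Option (Fin k)) (Sym N) where
  Q := A.S
  finQ := A.finS
  start := A.start
  instr q s :=
    match A.next q (fun i => (s (some i)).toBit) with
    | none => .halt true
    | some (q', d, e) => .move ⟨q',
        fun κ => κ.elim (e.elim (s none) sbit) fun i => s (some i),
        fun κ => κ.elim (e.map fun _ => Dir.right) d⟩

theorem core_det (A : Trans k) : (A.core : Core _ (Sym N)).Det := by
  intro q s m h
  rcases h' : A.next q (fun i => (s (some i)).toBit) with _ | ⟨q', d, e⟩ <;>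
    simp [core, h'] at h

/-- The output head always stands on the blank behind the symbols written so far, which are `L`
reversed; the induction needs `L` arbitrary. -/
theorem core_runs {A : Trans k} {s : A.S} {τ : Fin k → Tape (Sym N)} {out : List Bool} {n : ℕ}
    (h : A.Runs s τ out n) : ∀ (L : List Bool) (T : Option (Fin k) → Tape (Sym N)),
      (∀ i, T (some i) = τ i) → T none = btape L [] →
      ∃ T', (A.core : Core _ (Sym N)).Runs s T [] n T' true ∧
        T' none = btape (out.reverse ++ L) [] := by
  induction h with
  | @quit s τ h =>
    intro L T hT hT'
    refine ⟨T, .halt ?_, by simpa using hT'⟩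
    simp [core, hT, h]
  | @step s s' τ d e out n h _ ih =>
    intro L T hT hT'
    obtain ⟨T', hr, hT''⟩ := ih (e.toList ++ L) (Move.act (Q := A.S) ⟨s',
        fun κ => κ.elim (e.elim ((T none).head) sbit) fun i => (T (some i)).head,
        fun κ => κ.elim (e.map fun _ => Dir.right) d⟩ T) (fun i => by
          rcases hd : d i with _ | d' <;> simp [Move.act, Trans.step, hd, hT]) (by
          rcases e with _ | b
          · simp [Move.act]; rw [hT']
          · simp [Move.act, hT'])
    refine ⟨T', Core.Runs.move (C := A.core) (m := ⟨s', _, _⟩) ?_ hr, ?_⟩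
    · simp [core, hT, h]
    · rw [hT'']; rcases e with _ | b <;> simp

theorem fp (A : Trans k) (f : (Fin k → List Bool) → List Bool) (r : Polynomial ℕ)
    (hf : ∀ v, (f v).length ≤ r.eval (size v))
    (h : ∀ (N : ℕ) v, ∃ n ≤ r.eval (size v),
      A.Runs (N := N) A.start (fun i => str (v i)) (f v) n) : FP f := by
  -- At most `r` steps of the transducer, then at most `r + 2` steps to rewind the output tape.
  refine ⟨2 * r + 2, fun v => (hf v).trans (by simp; omega), 0, fun N _ =>
    ⟨_, inferInstance, A.core.bind fun _ => Core.rewind none {none}, .some, none,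
      A.core_det.bind fun _ => Core.rewind_det _ _, fun v => ?_⟩⟩
  obtain ⟨n, hn, hr⟩ := h N v
  obtain ⟨T', hr', hT'⟩ := core_runs hr [] (initTapes .some v) (fun i => initTapes_inp .some v i)
    (initTapes_of_ne _ _ (by simp))
  have h2 := Core.rewind_runs (S := {none}) (Set.mem_singleton none) ((f v).reverse) T' (by
    simpa using hT')
  refine ⟨n + ((f v).length + 2), ?_, _, _, Core.Runs.bind hr' (by simpa using h2), by simp⟩
  have := hf v
  simp only [Polynomial.eval_add, Polynomial.eval_mul, Polynomial.eval_ofNat]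
  omega

end Trans

end CLU

namespace CLU

open Turing

/-! ### Composition -/

/-- The tapes are blank except that the input tapes with indices in `s` hold the strings `v`. -/
def PartialInit {K : Type} {N k : ℕ} (inp : Fin k ↪ K) (v : Fin k → List Bool) (s : Set (Fin k))
    (T : K → Tape (Sym N)) : Prop :=
  ∀ κ, (∀ i ∈ s, inp i = κ → T κ = str (v i)) ∧ ((∀ i ∈ s, inp i ≠ κ) → T κ = default)

theorem partialInit_empty {K : Type} {N k : ℕ} (inp : Fin k ↪ K) (v : Fin k → List Bool)
    {T : K → Tape (Sym N)} (hT : ∀ κ, T κ = default) : PartialInit inp v ∅ T :=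
  fun κ => ⟨fun _ hi => hi.elim, fun _ => hT κ⟩

theorem PartialInit.eq {K : Type} {N k : ℕ} {inp : Fin k ↪ K} {v : Fin k → List Bool}
    {T : K → Tape (Sym N)} (h : PartialInit inp v Set.univ T) : T = initTapes inp v := by
  funext κ
  by_cases hκ : ∃ i, inp i = κ
  · obtain ⟨i, rfl⟩ := hκ
    rw [initTapes_inp, (h _).1 i (Set.mem_univ i) rfl]
  · rw [initTapes_of_ne _ _ fun i hi => hκ ⟨i, hi⟩, (h _).2 fun i _ hi => hκ ⟨i, hi⟩]

theorem PartialInit.insert {K : Type} {N k : ℕ} {inp : Fin k ↪ K} {v : Fin k → List Bool}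
    {s : Set (Fin k)} {T T' : K → Tape (Sym N)} (h : PartialInit inp v s T) (i : Fin k)
    (hi : T' (inp i) = str (v i)) (hT : ∀ κ, inp i ≠ κ → T' κ = T κ) :
    PartialInit inp v (insert i s) T' := by
  intro κ
  constructor
  · rintro j (rfl | hj) rfl
    · exact hi
    · by_cases hij : i = j
      · subst hij; exact hi
      · rw [hT _ fun h => hij (inp.injective h), (h _).1 j hj rfl]
  · intro hκ
    rw [hT κ (hκ i (Set.mem_insert _ _)), (h κ).2 fun j hj => hκ j (Set.mem_insert_of_mem _ hj)]

section

variable {n k N : ℕ} {Kg : Fin k → Type} {Kf : Type}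

/-- The tapes of the `i`-th inner control. -/
def innerTape (i : Fin k) : Kg i ↪ Fin n ⊕ (Σ i, Kg i) ⊕ Kf :=
  ⟨fun κ => Sum.inr (Sum.inl ⟨i, κ⟩), fun a b h => by simpa using h⟩

/-- The tapes of the outer control. -/
def outerTape : Kf ↪ Fin n ⊕ (Σ i, Kg i) ⊕ Kf :=
  ⟨fun κ => Sum.inr (Sum.inr κ), fun a b h => by simpa using h⟩

theorem innerTape_apply (i : Fin k) (κ : Kg i) :
    (innerTape i κ : Fin n ⊕ (Σ i, Kg i) ⊕ Kf) = Sum.inr (Sum.inl ⟨i, κ⟩) := rfl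

theorem outerTape_apply (κ : Kf) :
    (outerTape κ : Fin n ⊕ (Σ i, Kg i) ⊕ Kf) = Sum.inr (Sum.inr κ) := rfl

/-- The control that distributes the arguments to the inner controls. -/
noncomputable def distribute (inpg : ∀ i, Fin n ↪ Kg i) :
    Core (Fin n ⊕ (Σ i, Kg i) ⊕ Kf) (Sym N) :=
  Core.seq (Finset.univ.toList.map fun j : Fin n =>
    Core.copy (Sum.inl j) {κ | ∃ i, κ = innerTape i (inpg i j)})

/-- Each argument is copied to all inner controls in one pass. The invariant for a set `s` of
arguments: the originals are intact, every inner control holds exactly the arguments in `s`, and the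
outer tapes are blank. -/
theorem distribute_runs (inpg : ∀ i, Fin n ↪ Kg i) (v : Fin n → List Bool) :
    ∃ t ≤ n * (2 * size v + 2), ∃ T' b,
      (distribute (Kf := Kf) inpg : Core _ (Sym N)).Runs (distribute inpg).start
        (initTapes ⟨Sum.inl, Sum.inl_injective⟩ v) [] t T' b ∧
      (∀ i κ, T' (innerTape i κ) = initTapes (inpg i) v κ) ∧ ∀ κ, T' (outerTape κ) = default := by
  classical
  have := Core.seq_runs_univ
    (fun j : Fin n => (Core.copy (Sum.inl j) {κ | ∃ i, κ = innerTape i (inpg i j)} :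
      Core (Fin n ⊕ (Σ i, Kg i) ⊕ Kf) (Sym N)))
    (fun s T => (∀ j, T (Sum.inl j) = str (v j)) ∧
      (∀ i, PartialInit (inpg i) v s fun κ => T (innerTape i κ)) ∧
      ∀ κ, T (outerTape κ) = default) (2 * size v + 2) ?_
    (initTapes ⟨Sum.inl, Sum.inl_injective⟩ v) ?_
  · obtain ⟨t, ht, T', b, hr, h1, h2, h3⟩ := this
    rw [Fintype.card_fin] at ht
    exact ⟨t, ht, T', b, hr, fun i κ => congrFun (h2 i).eq κ, h3⟩
  · rintro j s T hj ⟨h1, h2, h3⟩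
    refine ⟨2 * (v j).length + 2, ?_, _, _, Core.copy_runs ?_ (v j) T (h1 j) ?_, ?_, ?_, ?_⟩
    · have := length_le_size v j; omega
    · simp [innerTape_apply]
    · rintro _ ⟨i, rfl⟩
      refine (h2 i _).2 fun j' hj' h => hj ?_
      rwa [← (inpg i).injective h]
    · intro j'
      simp [innerTape_apply, h1]
    · intro i
      refine (h2 i).insert j ?_ ?_
      · exact if_pos ⟨i, rfl⟩
      · intro κ hκ
        refine if_neg ?_
        rintro ⟨i', h⟩
        simp only [innerTape_apply, Sum.inr.injEq, Sum.inl.injEq] at h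
        cases h
        exact hκ rfl
    · intro κ
      rw [if_neg (by simp [innerTape_apply, outerTape_apply]), h3]
  · refine ⟨fun j => initTapes_inp ⟨Sum.inl, Sum.inl_injective⟩ v j, fun i =>
      partialInit_empty _ _ fun κ => ?_, fun κ => ?_⟩
    · exact initTapes_of_ne _ _ (by simp [innerTape_apply])
    · exact initTapes_of_ne _ _ (by simp [outerTape_apply])

/-- The control that computes the values of the inner functions and passes them to the outer
control. -/
noncomputable def evalInner (Cg : ∀ i, Core (Kg i) (Sym N)) (outg : ∀ i, Kg i)
    (inpf : Fin k ↪ Kf) : Core (Fin n ⊕ (Σ i, Kg i) ⊕ Kf) (Sym N) :=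
  Core.seq (Finset.univ.toList.map fun i : Fin k => ((Cg i).embed (innerTape i)).bind fun _ =>
    Core.copy (innerTape i (outg i)) {outerTape (inpf i)})

/-- The inner controls have disjoint tapes, so those not yet run still have their initial tapes.
Each needs `t` steps for its own work and `2 * t + 2` for copying its output to the outer control.
-/
theorem evalInner_runs (Cg : ∀ i, Core (Kg i) (Sym N)) (outg : ∀ i, Kg i) (inpf : Fin k ↪ Kf)
    (T₀ : ∀ i, Kg i → Tape (Sym N)) (y : Fin k → List Bool) (t : ℕ)
    (h : ∀ i, ∃ n ≤ t, ∃ T b, (Cg i).Runs (Cg i).start (T₀ i) [] n T b ∧ T (outg i) = str (y i))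
    (ht : ∀ i, (y i).length ≤ t) (T : Fin n ⊕ (Σ i, Kg i) ⊕ Kf → Tape (Sym N))
    (hT : ∀ i κ, T (innerTape i κ) = T₀ i κ) (hT' : ∀ κ, T (outerTape κ) = default) :
    ∃ t' ≤ k * (3 * t + 2), ∃ T' b,
      (evalInner Cg outg inpf).Runs (evalInner Cg outg inpf).start T [] t' T' b ∧
      ∀ κ, T' (outerTape κ) = initTapes inpf y κ := by
  classical
  have := Core.seq_runs_univ
    (fun i : Fin k => ((Cg i).embed (innerTape (n := n) (Kf := Kf) i)).bind fun _ =>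
      Core.copy (innerTape i (outg i)) {outerTape (inpf i)})
    (fun s T => (∀ i ∉ s, ∀ κ, T (innerTape i κ) = T₀ i κ) ∧
      PartialInit inpf y s fun κ => T (outerTape κ)) (3 * t + 2) ?_ T
    ⟨fun i _ => hT i, partialInit_empty _ _ hT'⟩
  · obtain ⟨t, ht, T', b, hr, h1, h2⟩ := this
    rw [Fintype.card_fin] at ht
    exact ⟨t, ht, T', b, hr, fun κ => congrFun h2.eq κ⟩
  · rintro i s T hi ⟨h1, h2⟩
    obtain ⟨m, hm, T₁, b, hr, hout⟩ := h i
    have hr1 := hr.embed' (innerTape (n := n) (Kf := Kf) i) T (h1 i hi)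
    have hne : ∀ κ, ¬ ∃ j, innerTape (n := n) (Kf := Kf) (Kg := Kg) i j = outerTape κ := by
      simp [innerTape_apply, outerTape_apply]
    have hr2 := Core.copy_runs (a := innerTape i (outg i)) (S := {outerTape (inpf i)})
      (by simp [innerTape_apply, outerTape_apply]) (y i) (Function.extend (innerTape i) T₁ T)
      (by rw [(innerTape i).injective.extend_apply, hout]) (by
        rintro _ rfl
        rw [Function.extend_apply' _ _ _ (hne _)]
        refine (h2 _).2 fun j hj h => hi ?_
        rwa [← inpf.injective h])
    refine ⟨m + (2 * (y i).length + 2), ?_, _, _,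
      Core.Runs.bind (D := fun _ => Core.copy (innerTape i (outg i)) {outerTape (inpf i)}) hr1 hr2,
      ?_, ?_⟩
    · have := ht i; omega
    · intro j hj κ
      rw [Set.mem_insert_iff, not_or] at hj
      rw [if_neg (by simp [innerTape_apply, outerTape_apply]), Function.extend_apply', h1 j hj.2]
      rintro ⟨κ', h⟩
      simp only [innerTape_apply, Sum.inr.injEq, Sum.inl.injEq] at h
      cases h
      exact hj.1 rfl
    · refine h2.insert i (by simp) fun κ hκ => ?_
      rw [if_neg, Function.extend_apply' _ _ _ (hne _)]
      simpa [outerTape_apply] using Ne.symm hκ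

end

/-- The length bound in `FP` keeps the intermediate strings polynomial. All controls can share one
alphabet because each of them is available for every sufficiently large `N`. -/
theorem FP.comp {k n : ℕ} {f : (Fin k → List Bool) → List Bool} (hf : FP f)
    {g : Fin k → (Fin n → List Bool) → List Bool} (hg : ∀ i, FP (g i)) :
    FP fun v => f fun i => g i v := by
  obtain ⟨rf, hlf, Nf, hf⟩ := hf
  choose rg hlg Ng hg using hg
  -- With natural coefficients, the sum dominates each `rg i`, and it also bounds the total length
  -- of the inner values.
  let R := ∑ i, rg i
  have hR : ∀ i m, (rg i).eval m ≤ R.eval m := fun i m => by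
    rw [Polynomial.eval_finsetSum]
    exact Finset.single_le_sum (f := fun i => (rg i).eval m) (fun _ _ => Nat.zero_le _)
      (Finset.mem_univ i)
  have hsize : ∀ v, size (fun i => g i v) ≤ R.eval (size v) := fun v => by
    rw [Polynomial.eval_finsetSum]
    exact Finset.sum_le_sum fun i _ => hlg i v
  have hrf : ∀ v, rf.eval (size fun i => g i v) ≤ (rf.comp R).eval (size v) := fun v => by
    rw [Polynomial.eval_comp]
    exact eval_mono rf (hsize v)
  -- The summands are the times for the outer function, for distributing the `n` arguments, and for
  -- the `k` inner functions.
  refine ⟨rf.comp R + (n : Polynomial ℕ) * (2 * Polynomial.X + 2) + (k : Polynomial ℕ) *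
    (3 * R + 2), fun v => ((hlf _).trans (hrf v)).trans ?_, Nf + ∑ i, Ng i, fun N hN => ?_⟩
  · simp only [Polynomial.eval_add]; omega
  have hNg : ∀ i, Ng i ≤ N := fun i => by
    have := Finset.single_le_sum (f := Ng) (fun _ _ => Nat.zero_le _) (Finset.mem_univ i)
    omega
  obtain ⟨Kf, _, Cf, inpf, outf, hdf, hf⟩ := hf N (by omega)
  choose Kg _ Cg inpg outg hdg hg using fun i => hg i N (hNg i)
  refine ⟨Fin n ⊕ (Σ i, Kg i) ⊕ Kf, inferInstance, (distribute inpg).bind fun _ =>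
    (evalInner Cg outg inpf).bind fun _ => Cf.embed outerTape, ⟨Sum.inl, Sum.inl_injective⟩,
    outerTape outf, ?_, fun v => ?_⟩
  · refine Core.Det.bind (Core.seq_det ?_) fun _ => Core.Det.bind (Core.seq_det ?_) fun _ =>
      hdf.embed _
    · simp only [List.mem_map, Finset.mem_toList, Finset.mem_univ, true_and]
      rintro _ ⟨j, rfl⟩
      exact Core.copy_det _ _
    · simp only [List.mem_map, Finset.mem_toList, Finset.mem_univ, true_and]
      rintro _ ⟨i, rfl⟩
      exact ((hdg i).embed _).bind fun _ => Core.copy_det _ _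
  obtain ⟨t₁, ht₁, T₁, b₁, hr₁, h₁, h₁'⟩ := distribute_runs (N := N) (Kf := Kf) inpg v
  obtain ⟨t₂, ht₂, T₂, b₂, hr₂, h₂⟩ := evalInner_runs (n := n) Cg outg inpf
    (fun i => initTapes (inpg i) v) (fun i => g i v) (R.eval (size v)) (fun i => by
      obtain ⟨m, hm, h⟩ := hg i v
      exact ⟨m, hm.trans (hR i _), h⟩) (fun i => (hlg i v).trans (hR i _)) T₁ h₁ h₁'
  obtain ⟨t₃, ht₃, T₃, b₃, hr₃, h₃⟩ := hf fun i => g i v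
  refine ⟨t₁ + (t₂ + t₃), ?_, _, _, Core.Runs.bind hr₁ (Core.Runs.bind hr₂
    (hr₃.embed' outerTape T₂ h₂)), ?_⟩
  · have := hrf v
    simp only [Polynomial.eval_add, Polynomial.eval_mul, Polynomial.eval_natCast,
      Polynomial.eval_ofNat, Polynomial.eval_X, Nat.cast_id]
    omega
  · rw [outerTape.injective.extend_apply, h₃]

theorem FP.comp₁ {n : ℕ} {f : (Fin 1 → List Bool) → List Bool} (hf : FP f)
    {g : (Fin n → List Bool) → List Bool} (hg : FP g) : FP fun v => f ![g v] := by
  convert hf.comp (g := ![g]) (by simpa using hg) using 3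
  funext i; fin_cases i; rfl

theorem FP.comp₂ {n : ℕ} {f : (Fin 2 → List Bool) → List Bool} (hf : FP f)
    {g₁ g₂ : (Fin n → List Bool) → List Bool} (h₁ : FP g₁) (h₂ : FP g₂) :
    FP fun v => f ![g₁ v, g₂ v] := by
  convert hf.comp (g := ![g₁, g₂]) (by simp [Fin.forall_fin_succ, h₁, h₂]) using 3
  funext i; fin_cases i <;> rfl

theorem FP.comp₃ {n : ℕ} {f : (Fin 3 → List Bool) → List Bool} (hf : FP f)
    {g₁ g₂ g₃ : (Fin n → List Bool) → List Bool} (h₁ : FP g₁) (h₂ : FP g₂) (h₃ : FP g₃) :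
    FP fun v => f ![g₁ v, g₂ v, g₃ v] := by
  convert hf.comp (g := ![g₁, g₂, g₃]) (by simp [Fin.forall_fin_succ, h₁, h₂, h₃]) using 3
  funext i; fin_cases i <;> rfl

end CLU

namespace CLU

open Turing

/-! ### Basic functions -/

namespace Trans

variable {k N : ℕ}

/-- Advance the head of the tape `i` only. -/
def only (i : Fin k) : Fin k → Option Dir := fun j => if j = i then some Dir.right else none

/-- Advance all heads. -/
def all : Fin k → Option Dir := fun _ => some Dir.right

/-- Move no head. -/
def stay : Fin k → Option Dir := fun _ => none

theorem step_only_self (i : Fin k) (T : Fin k → Tape (Sym N)) :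
    step (only i) T i = (T i).move Dir.right := by simp [step, only]

theorem step_only_ne {i j : Fin k} (h : j ≠ i) (T : Fin k → Tape (Sym N)) :
    step (only i) T j = T j := by simp [step, only, h]

@[simp]
theorem step_all (T : Fin k → Tape (Sym N)) (i : Fin k) :
    step all T i = (T i).move Dir.right := rfl

@[simp]
theorem step_stay (T : Fin k → Tape (Sym N)) : step stay T = T := rfl

theorem Runs.step' {A : Trans k} {s s' : A.S} {T : Fin k → Tape (Sym N)} {d : Fin k → Option Dir}
    {out : List Bool} {n : ℕ} (h : A.next s (fun i => (T i).head.toBit) = some (s', d, none))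
    (hr : A.Runs s' (Trans.step d T) out n) : A.Runs s T out (n + 1) :=
  Runs.step h hr

theorem Runs.emit {A : Trans k} {s s' : A.S} {T : Fin k → Tape (Sym N)} {d : Fin k → Option Dir}
    {out : List Bool} {b : Bool} {n : ℕ}
    (h : A.next s (fun i => (T i).head.toBit) = some (s', d, some b))
    (hr : A.Runs s' (Trans.step d T) out n) : A.Runs s T (b :: out) (n + 1) :=
  Runs.step h hr

/-- The instruction to copy the rest of the tape `i`. -/
def copyNext {S : Type} (s : S) (i : Fin k) (h : Fin k → Option Bool) :
    Option (S × (Fin k → Option Dir) × Option Bool) :=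
  (h i).map fun b => (s, only i, some b)

theorem runs_copy {A : Trans k} {s : A.S} {i : Fin k} (hA : A.next s = copyNext s i) :
    ∀ (L R : List Bool) (T : Fin k → Tape (Sym N)), T i = btape L R → A.Runs s T R R.length
  | L, [], T, hT => .quit (by simp [hA, copyNext, hT])
  | L, c :: R, T, hT => by
    refine .emit (s' := s) (d := only i) (by simp [hA, copyNext, hT]) (runs_copy hA (c :: L) R _ ?_)
    rw [step_only_self, hT, btape_move_right]

end Trans

open CLU.Trans

theorem FP.proj {k : ℕ} (i : Fin k) : FP fun v : Fin k → List Bool => v i := by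
  refine Trans.fp ⟨Unit, inferInstance, (), fun s => copyNext s i⟩ _ Polynomial.X
    (fun v => by simpa using length_le_size v i) fun N v => ⟨_, ?_, runs_copy rfl [] _ _ rfl⟩
  simpa using length_le_size v i

theorem FP.nil {k : ℕ} : FP fun _ : Fin k → List Bool => [] :=
  Trans.fp ⟨Unit, inferInstance, (), fun _ _ => none⟩ _ 0 (fun v => by simp)
    fun N v => ⟨0, by simp, .quit rfl⟩

theorem FP.singleton {k : ℕ} (b : Bool) : FP fun _ : Fin k → List Bool => [b] :=
  Trans.fp ⟨Bool, inferInstance, false, fun s _ => if s then none else some (true, stay, some b)⟩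
    _ 1 (fun v => by simp) fun N v => ⟨1, by simp, .emit (s' := true) (d := stay) rfl (.quit rfl)⟩

/-- If the first string is nonempty then the second string, else the third one. -/
def cond : (Fin 3 → List Bool) → List Bool := fun v => if v 0 = [] then v 2 else v 1

theorem fp_cond : FP cond := by
  refine Trans.fp ⟨Option (Fin 3), inferInstance, none, fun s h => match s with
    | none => some (some (if h 0 = none then 2 else 1), stay, none)
    | some i => copyNext (some i) i h⟩ _ (Polynomial.X + 1) (fun v => ?_) fun N v =>
    ⟨(cond v).length + 1, ?_, ?_⟩
  · have := length_le_size v 1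
    have := length_le_size v 2
    unfold cond
    split <;> simp <;> omega
  · have := length_le_size v 1
    have := length_le_size v 2
    unfold cond
    split <;> simp <;> omega
  · rcases h : v 0 with _ | ⟨c, u⟩
    · refine .step' (s' := some (2 : Fin 3)) (d := stay) (by simp [h]) ?_
      simp only [step_stay, cond, h, if_true]
      exact runs_copy rfl [] _ _ rfl
    · refine .step' (s' := some (1 : Fin 3)) (d := stay) (by simp [h]) ?_
      simp only [step_stay, cond, h, reduceCtorEq, if_false]
      exact runs_copy rfl [] _ _ rfl

theorem FP.ite {k : ℕ} {g f₁ f₂ : (Fin k → List Bool) → List Bool} (hg : FP g) (h₁ : FP f₁)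
    (h₂ : FP f₂) : FP fun v => if g v = [] then f₂ v else f₁ v :=
  fp_cond.comp₃ hg h₁ h₂

/-- The transducer for concatenation. -/
def appendTrans : Trans 2 where
  S := Bool
  finS := inferInstance
  start := false
  next
    | false, h => match h 0 with
      | some b => some (false, only 0, some b)
      | none => some (true, stay, none)
    | true, h => copyNext true 1 h

theorem appendTrans_runs {N : ℕ} : ∀ (L u v : List Bool) (T : Fin 2 → Tape (Sym N)),
    T 0 = btape L u → T 1 = str v → appendTrans.Runs false T (u ++ v) (u.length + v.length + 1)
  | L, [], v, T, h0, h1 => by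
    rw [List.nil_append, List.length_nil, zero_add]
    exact .step' (s' := true) (d := stay) (by simp [appendTrans, h0]) (runs_copy rfl [] _ _ h1)
  | L, c :: u, v, T, h0, h1 => by
    rw [List.length_cons, add_right_comm u.length]
    refine .emit (s' := false) (d := only 0) (by simp [appendTrans, h0])
      (appendTrans_runs (c :: L) u v _ ?_ ?_)
    · rw [step_only_self, h0, btape_move_right]
    · rw [step_only_ne (by decide), h1]

theorem FP.append {k : ℕ} {f₁ f₂ : (Fin k → List Bool) → List Bool} (h₁ : FP f₁) (h₂ : FP f₂) :
    FP fun v => f₁ v ++ f₂ v := by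
  have h : FP fun v : Fin 2 → List Bool => v 0 ++ v 1 := by
    refine Trans.fp appendTrans _ (Polynomial.X + 1) (fun v => ?_) fun N v =>
      ⟨_, ?_, appendTrans_runs [] _ _ _ rfl rfl⟩ <;> simp [size, Fin.sum_univ_two]
  exact h.comp₂ h₁ h₂

/-- The transducer for the initial part of the second string as long as the first string. -/
def takeTrans : Trans 2 where
  S := Unit
  finS := inferInstance
  start := ()
  next _ h := match h 0, h 1 with
    | some _, some b => some ((), all, some b)
    | _, _ => none

theorem takeTrans_runs {N : ℕ} : ∀ (L L' u v : List Bool) (T : Fin 2 → Tape (Sym N)),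
    T 0 = btape L u → T 1 = btape L' v → ∃ n ≤ v.length, takeTrans.Runs () T (v.take u.length) n
  | L, L', [], v, T, h0, h1 => ⟨0, by simp, .quit (by simp [takeTrans, h0])⟩
  | L, L', c :: u, [], T, h0, h1 => ⟨0, by simp, .quit (by simp [takeTrans, h0, h1])⟩
  | L, L', c :: u, b :: v, T, h0, h1 => by
    obtain ⟨n, hn, hr⟩ := takeTrans_runs (c :: L) (b :: L') u v (step all T) (by simp [h0])
      (by simp [h1])
    exact ⟨n + 1, by simpa using hn,
      .emit (s' := ()) (d := all) (by simp [takeTrans, h0, h1]) hr⟩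

theorem FP.take {k : ℕ} {f₁ f₂ : (Fin k → List Bool) → List Bool} (h₁ : FP f₁) (h₂ : FP f₂) :
    FP fun v => (f₂ v).take (f₁ v).length := by
  have h : FP fun v : Fin 2 → List Bool => (v 1).take (v 0).length := by
    refine Trans.fp takeTrans _ Polynomial.X (fun v => ?_) fun N v => ?_
    · have := length_le_size v 1
      simp; omega
    · obtain ⟨n, hn, hr⟩ := takeTrans_runs (N := N) [] [] (v 0) (v 1) (fun i => str (v i)) rfl rfl
      exact ⟨n, by simpa using hn.trans (length_le_size v 1), hr⟩
  exact h.comp₂ h₁ h₂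

/-- The transducer for the part of the second string beyond the length of the first string. -/
def dropTrans : Trans 2 where
  S := Bool
  finS := inferInstance
  start := false
  next
    | false, h => match h 0, h 1 with
      | some _, some _ => some (false, all, none)
      | some _, none => none
      | none, _ => some (true, stay, none)
    | true, h => copyNext true 1 h

theorem dropTrans_runs {N : ℕ} : ∀ (L L' u v : List Bool) (T : Fin 2 → Tape (Sym N)),
    T 0 = btape L u → T 1 = btape L' v →
    ∃ n ≤ v.length + 1, dropTrans.Runs false T (v.drop u.length) n
  | L, L', [], v, T, h0, h1 => ⟨v.length + 1, le_rfl,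
      .step' (s' := true) (d := stay) (by simp [dropTrans, h0]) (runs_copy rfl L' _ _ h1)⟩
  | L, L', c :: u, [], T, h0, h1 => ⟨0, by simp, .quit (by simp [dropTrans, h0, h1])⟩
  | L, L', c :: u, b :: v, T, h0, h1 => by
    obtain ⟨n, hn, hr⟩ := dropTrans_runs (c :: L) (b :: L') u v (step all T) (by simp [h0])
      (by simp [h1])
    exact ⟨n + 1, by simpa using hn,
      .step' (s' := false) (d := all) (by simp [dropTrans, h0, h1]) hr⟩

theorem FP.drop {k : ℕ} {f₁ f₂ : (Fin k → List Bool) → List Bool} (h₁ : FP f₁) (h₂ : FP f₂) :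
    FP fun v => (f₂ v).drop (f₁ v).length := by
  have h : FP fun v : Fin 2 → List Bool => (v 1).drop (v 0).length := by
    refine Trans.fp dropTrans _ (Polynomial.X + 1) (fun v => ?_) fun N v => ?_
    · have := length_le_size v 1
      simp; omega
    · obtain ⟨n, hn, hr⟩ := dropTrans_runs (N := N) [] [] (v 0) (v 1) (fun i => str (v i)) rfl rfl
      have := length_le_size v 1
      exact ⟨n, by simp; omega, hr⟩
  exact h.comp₂ h₁ h₂

/-- The transducer that replaces all symbols by `c`. -/
def fillTrans (c : Bool) : Trans 1 where
  S := Unit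
  finS := inferInstance
  start := ()
  next _ h := (h 0).map fun _ => ((), all, some c)

theorem fillTrans_runs {N : ℕ} (c : Bool) : ∀ (L u : List Bool) (T : Fin 1 → Tape (Sym N)),
    T 0 = btape L u → (fillTrans c).Runs () T (List.replicate u.length c) u.length
  | L, [], T, h0 => .quit (by simp [fillTrans, h0])
  | L, b :: u, T, h0 => .emit (s' := ()) (d := all) (by simp [fillTrans, h0])
      (fillTrans_runs c (b :: L) u _ (by simp [h0]))

theorem FP.fill {k : ℕ} (c : Bool) {f : (Fin k → List Bool) → List Bool} (hf : FP f) :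
    FP fun v => List.replicate (f v).length c := by
  have h : FP fun v : Fin 1 → List Bool => List.replicate (v 0).length c :=
    Trans.fp (fillTrans c) _ Polynomial.X (fun v => by simpa using length_le_size v 0)
      fun N v => ⟨_, by simpa using length_le_size v 0, fillTrans_runs c [] _ _ rfl⟩
  exact h.comp₁ hf

/-- The transducer that deletes all zeros at the beginning. -/
def stripTrans : Trans 1 where
  S := Bool
  finS := inferInstance
  start := false
  next
    | false, h => match h 0 with
      | some false => some (false, all, none)
      | some true => some (true, stay, none)
      | none => none
    | true, h => copyNext true 0 h

theorem stripTrans_runs {N : ℕ} : ∀ (L u : List Bool) (T : Fin 1 → Tape (Sym N)),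
    T 0 = btape L u → ∃ n ≤ u.length + 1, stripTrans.Runs false T (u.dropWhile (!·)) n
  | L, [], T, h0 => ⟨0, by simp, .quit (by simp [stripTrans, h0])⟩
  | L, true :: u, T, h0 => ⟨u.length + 1 + 1, by simp,
      .step' (s' := true) (d := stay) (by simp [stripTrans, h0]) (runs_copy rfl L _ _ h0)⟩
  | L, false :: u, T, h0 => by
    obtain ⟨n, hn, hr⟩ := stripTrans_runs (false :: L) u (step all T) (by simp [h0])
    exact ⟨n + 1, by simpa using hn,
      .step' (s' := false) (d := all) (by simp [stripTrans, h0]) hr⟩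

theorem FP.strip {k : ℕ} {f : (Fin k → List Bool) → List Bool} (hf : FP f) :
    FP fun v => (f v).dropWhile (!·) := by
  have h : FP fun v : Fin 1 → List Bool => (v 0).dropWhile (!·) := by
    refine Trans.fp stripTrans _ (Polynomial.X + 1) (fun v => ?_) fun N v => ?_
    · have h1 := length_le_size v 0
      have h2 := (List.dropWhile_sublist (!·) (l := v 0)).length_le
      simp only [Polynomial.eval_add, Polynomial.eval_X, Polynomial.eval_one]
      omega
    · obtain ⟨n, hn, hr⟩ := stripTrans_runs (N := N) [] (v 0) (fun i => str (v i)) rfl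
      have := length_le_size v 0
      exact ⟨n, by simp; omega, hr⟩
  exact h.comp₁ hf

/-! ### Automata on pairs of strings -/

/-- Evaluate a finite automaton that reads two strings of the same length in parallel. -/
def pairEval {S : Type} (δ : S → Bool → Bool → Option S) (F : S → Bool) :
    S → List Bool → List Bool → Bool
  | s, [], [] => F s
  | s, a :: u, b :: v => match δ s a b with
    | none => false
    | some s' => pairEval δ F s' u v
  | _, _, _ => false

/-- The transducer that evaluates an automaton. -/
def pairTrans {S : Type} [Finite S] (δ : S → Bool → Bool → Option S) (F : S → Bool) (s₀ : S) :
    Trans 2 where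
  S := Option S
  finS := inferInstance
  start := some s₀
  next
    | none, _ => none
    | some s, h => match h 0, h 1 with
      | none, none => if F s then some (none, stay, some true) else none
      | some a, some b => (δ s a b).map fun s' => (some s', all, none)
      | _, _ => none

theorem pairTrans_runs {S : Type} [Finite S] (δ : S → Bool → Bool → Option S) (F : S → Bool)
    (s₀ : S) {N : ℕ} : ∀ (s : S) (L L' u v : List Bool) (T : Fin 2 → Tape (Sym N)),
    T 0 = btape L u → T 1 = btape L' v → ∃ n ≤ u.length + 1,
      (pairTrans δ F s₀).Runs (some s) T (if pairEval δ F s u v then [true] else []) n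
  | s, L, L', [], [], T, h0, h1 => by
    cases hF : F s
    · exact ⟨0, by simp, by
        simpa [pairEval, hF] using Runs.quit (by simp [pairTrans, h0, h1, hF])⟩
    · refine ⟨1, by simp, ?_⟩
      simp only [pairEval, hF, if_true]
      exact .emit (s' := none) (d := stay) (by simp [pairTrans, h0, h1, hF]) (.quit rfl)
  | s, L, L', [], b :: v, T, h0, h1 => ⟨0, by simp, by
      simpa [pairEval] using Runs.quit (by simp [pairTrans, h0, h1])⟩
  | s, L, L', a :: u, [], T, h0, h1 => ⟨0, by simp, by
      simpa [pairEval] using Runs.quit (by simp [pairTrans, h0, h1])⟩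
  | s, L, L', a :: u, b :: v, T, h0, h1 => by
    rcases hδ : δ s a b with _ | s'
    · exact ⟨0, by simp, by
        simpa [pairEval, hδ] using Runs.quit (by simp [pairTrans, h0, h1, hδ])⟩
    · obtain ⟨n, hn, hr⟩ := pairTrans_runs δ F s₀ s' (a :: L) (b :: L') u v (step all T)
        (by simp [h0]) (by simp [h1])
      refine ⟨n + 1, by simpa using hn, ?_⟩
      simp only [pairEval, hδ]
      exact .step' (s' := some s') (d := all) (by simp [pairTrans, h0, h1, hδ]) hr

theorem FP.pairEval {S : Type} [Finite S] (δ : S → Bool → Bool → Option S) (F : S → Bool) (s : S)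
    {k : ℕ} {f₁ f₂ : (Fin k → List Bool) → List Bool} (h₁ : FP f₁) (h₂ : FP f₂) :
    FP fun v => if CLU.pairEval δ F s (f₁ v) (f₂ v) then [true] else [] := by
  have h : FP fun v : Fin 2 → List Bool =>
      if CLU.pairEval δ F s (v 0) (v 1) then [true] else [] := by
    refine Trans.fp (pairTrans δ F s) _ (Polynomial.X + 1) (fun v => ?_) fun N v => ?_
    · split <;> simp
    · obtain ⟨n, hn, hr⟩ := pairTrans_runs δ F s (N := N) s [] [] (v 0) (v 1) (fun i => str (v i)) rfl rfl
      have := length_le_size v 0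
      exact ⟨n, by simp; omega, hr⟩
  exact h.comp₂ h₁ h₂

/-! ### Unary arithmetic -/

/-- The transducer that multiplies lengths: for each symbol of the first string, it reads the second
string once. -/
def mulTrans : Trans 2 where
  S := Fin 3
  finS := inferInstance
  start := 0
  next
    | 0, h => (h 0).map fun _ => (1, only 0, none)
    | 1, h => match h 1 with
      | some _ => some (1, only 1, some true)
      | none => some (2, fun i => if i = 1 then some Dir.left else none, none)
    | 2, h => match h 1 with
      | some _ => some (2, fun i => if i = 1 then some Dir.left else none, none)
      | none => some (0, only 1, none)

theorem mulTrans_runs_two {N : ℕ} {out : List Bool} {n : ℕ} :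
    ∀ (L v : List Bool) (T : Fin 2 → Tape (Sym N)),
      T 1 = (btape L v).move Dir.left →
      mulTrans.Runs (0 : Fin 3) ![T 0, str (L.reverse ++ v)] out n →
      mulTrans.Runs (2 : Fin 3) T out (n + L.length + 1)
  | [], v, T, h1, hr => by
    have hT : T 1 = Tape.mk₂ [] (none :: v.map sbit) := by rw [h1]; simp [btape]
    refine .step' (s' := (0 : Fin 3)) (d := only 1) (by simp [mulTrans, hT]) ?_
    have hT' : step (only 1) T = ![T 0, str ([].reverse ++ v)] := by
      funext i
      fin_cases i
      · rfl
      refine (step_only_self _ _).trans ?_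
      rw [hT, mk₂_move_right, ← Sym.default_eq_none, mk₂_default_left]
      simp [btape]
    rw [hT']
    exact hr
  | c :: L, v, T, h1, hr => by
    refine .step' (s' := (2 : Fin 3)) (d := fun i => if i = 1 then some Dir.left else none)
      (by simp [mulTrans, h1]) (mulTrans_runs_two L (c :: v) _ ?_ ?_)
    · simp [step, h1]
    · simpa [step] using hr

/-- One round: the head emits a one for each symbol of `v` on the way right, turns, walks back over
`v` and `L`, and the run continues from state `0` with the second tape restored. -/
theorem mulTrans_runs_one {N : ℕ} {out : List Bool} {n : ℕ} :
    ∀ (v L : List Bool) (T : Fin 2 → Tape (Sym N)), T 1 = btape L v →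
      mulTrans.Runs (0 : Fin 3) ![T 0, str (L.reverse ++ v)] out n →
      mulTrans.Runs (1 : Fin 3) T (List.replicate v.length true ++ out)
        (n + 2 * v.length + L.length + 2)
  | [], L, T, h1, hr => by
    refine .step' (s' := (2 : Fin 3)) (d := fun i => if i = 1 then some Dir.left else none)
      (by simp [mulTrans, h1]) (mulTrans_runs_two L [] _ ?_ ?_)
    · simp [step, h1]
    · simpa [step] using hr
  | c :: v, L, T, h1, hr => by
    have := mulTrans_runs_one v (c :: L) (step (only 1) T)
      (by rw [step_only_self, h1, btape_move_right])
      (by rw [step_only_ne (by decide)]; simpa using hr)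
    convert Runs.emit (A := mulTrans) (s := (1 : Fin 3)) (s' := (1 : Fin 3)) (d := only 1)
      (b := true) (by simp [mulTrans, h1]) this using 1
    · simp [List.replicate_succ]
    · simp only [List.length_cons]; omega

theorem mulTrans_runs {N : ℕ} (v : List Bool) :
    ∀ (u L : List Bool), mulTrans.Runs (N := N) (0 : Fin 3) ![btape L u, str v]
      (List.replicate (u.length * v.length) true) (u.length * (2 * v.length + 3))
  | [], L => by
    simpa using Runs.quit (by simp [mulTrans])
  | c :: u, L => by
    have h := mulTrans_runs_one (N := N) v [] (step (only 0) ![btape L (c :: u), str v])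
      (by rw [step_only_ne (by decide)]; rfl)
      (by simpa [step_only_self] using mulTrans_runs v u (c :: L))
    convert Runs.step' (A := mulTrans) (s := (0 : Fin 3)) (s' := (1 : Fin 3)) (d := only 0)
      (by simp [mulTrans]) h using 1
    · rw [List.replicate_append_replicate, List.length_cons]; ring_nf
    · simp only [List.length_cons, List.length_nil]; ring

theorem FP.mul {k : ℕ} {f₁ f₂ : (Fin k → List Bool) → List Bool} (h₁ : FP f₁) (h₂ : FP f₂) :
    FP fun v => List.replicate ((f₁ v).length * (f₂ v).length) true := by
  have h : FP fun v : Fin 2 → List Bool => List.replicate ((v 0).length * (v 1).length) true := by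
    refine Trans.fp mulTrans _ (Polynomial.X * (2 * Polynomial.X + 3)) (fun v => ?_) fun N v =>
      ⟨(v 0).length * (2 * (v 1).length + 3), ?_, ?_⟩
    · have h0 := length_le_size v 0
      have h1 := length_le_size v 1
      simpa using Nat.mul_le_mul h0 (by omega)
    · have h0 := length_le_size v 0
      have h1 := length_le_size v 1
      simpa using Nat.mul_le_mul h0 (by omega)
    · have hT : (fun i => str (v i) : Fin 2 → Tape (Sym N)) = ![btape [] (v 0), str (v 1)] := by
        funext i
        fin_cases i <;> rfl
      rw [hT]
      exact mulTrans_runs (v 1) (v 0) []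
  exact h.comp₂ h₁ h₂

/-- The values of a polynomial at the length of a string can be computed in unary. -/
theorem FP.poly {k : ℕ} {f : (Fin k → List Bool) → List Bool} (hf : FP f) (r : Polynomial ℕ) :
    FP fun v => List.replicate (r.eval (f v).length) true := by
  -- Sums become concatenation; a monomial is built from its coefficient, written out symbol by
  -- symbol, by repeated multiplication with the length.
  induction r using Polynomial.induction_on' with
  | add p q hp hq => simpa [List.replicate_append_replicate] using hp.append hq
  | monomial n a =>
    induction n with
    | zero =>
      induction a with
      | zero => simpa using FP.nil
      | succ a ih =>
        simpa [← List.replicate_succ'] using ih.append (FP.singleton true)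
    | succ n ih =>
      simpa [pow_succ, mul_assoc] using ih.mul hf

end CLU

namespace CLU

open Turing

/-! ### Simulating a given machine -/

namespace NTM

variable {a N : ℕ}

/-- For all large `N`, the alphabet of the machine can be embedded into the common alphabet. -/
theorem exists_encoding (M : NTM a) : ∃ N₀, ∀ N ≥ N₀,
    ∃ (e : PointedMap M.Γ (Sym N)) (d : Sym N → M.Γ), (∀ γ, d (e γ) = γ) ∧
      ∀ b, e (M.bit b) = sbit b := by
  classical
  have := M.finΓ
  obtain ⟨N₀, ⟨ι⟩⟩ := Finite.exists_equiv_fin M.Γ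
  refine ⟨N₀, fun N hN => ?_⟩
  -- Blanks go to blanks, as mapping whole tapes requires, and bits to bits; only the other symbols
  -- use the numbering `ι`.
  let e : M.Γ → Sym N := fun γ =>
    if γ = default then none
    else if γ = M.bit true then sbit true
    else if γ = M.bit false then sbit false
    else some (Sum.inr (Fin.castLE hN (ι γ)))
  have hb : M.bit false ≠ M.bit true := fun h => by simpa using M.bit_injective h
  have he : Function.Injective e := by
    intro γ γ' h
    simp only [e, sbit] at h
    split_ifs at h <;> simp_all
  refine ⟨⟨e, if_pos rfl⟩, Function.invFun e, Function.leftInverse_invFun he, fun b => ?_⟩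
  cases b
  · simp [e, M.bit_ne_blank, hb]
  · simp [e, M.bit_ne_blank]

variable (M : NTM a) (e : PointedMap M.Γ (Sym N)) (d : Sym N → M.Γ)

/-- A move of `M`, together with a given action on an additional tape. -/
def extendMove (m : Move M.K M.Γ M.Q) (g : Sym N) (D : Option Dir) :
    Move (Option M.K) (Sym N) M.Q :=
  ⟨m.next, fun κ => κ.elim g fun k => e (m.write k), fun κ => κ.elim D m.dir⟩

/-- The control that works like `M`, but gets its guesses from an additional tape: `γ` tells how to
interpret and how to change the symbols on it. -/
def oracle (γ : Sym N → Option (Bool × Sym N)) (ok : Sym N → Bool) :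
    Core (Option M.K) (Sym N) where
  Q := M.Q
  finQ := M.finQ
  start := M.start
  instr q s := match M.instr q fun k => d (s (some k)) with
    | .halt b => .halt (b && ok (s none))
    | .move m => .move (M.extendMove e m (s none) none)
    | .guess m => match γ (s none) with
      | none => .halt false
      | some (b, g) => .move (M.extendMove e (m b) g (some Dir.right))

theorem oracle_det (γ : Sym N → Option (Bool × Sym N)) (ok : Sym N → Bool) :
    (M.oracle e d γ ok).Det := by
  intro q s m h
  rcases h' : M.instr q fun k => d (s (some k)) with _ | _ | m'
  · simp [oracle, h'] at h
  · simp [oracle, h'] at h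
  · rcases h'' : γ (s none) with _ | ⟨b, g⟩ <;> simp [oracle, h', h''] at h

/-- The tapes of a configuration together with an additional tape. -/
def oracleTapes (c : M.Cfg) (G : Tape (Sym N)) : Option M.K → Tape (Sym N) :=
  fun κ => κ.elim G fun k => (c.tapes k).map e

theorem act_extendMove (m : Move M.K M.Γ M.Q) (g : Sym N) (D : Option Dir) (c : M.Cfg)
    (G : Tape (Sym N)) : (M.extendMove e m g D).act (M.oracleTapes e c G) =
      M.oracleTapes e (M.apply m c) (D.elim (G.write g) fun D => (G.write g).move D) := by
  funext κ
  rcases κ with _ | k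
  · rcases D with _ | D <;> rfl
  · rcases h : m.dir k with _ | D' <;>
      simp [Move.act, extendMove, oracleTapes, apply, h, Tape.map_move]

variable {e d}

theorem due_eq (hd : ∀ γ, d (e γ) = γ) (c : M.Cfg) (G : Tape (Sym N)) :
    M.instr c.state (fun k => d (M.oracleTapes e c G (some k)).head) = M.due c := by
  simp [oracleTapes, hd, due]

variable {M} {γ : Sym N → Option (Bool × Sym N)} {ok : Sym N → Bool}

theorem oracle_halt (hd : ∀ γ, d (e γ) = γ) {c : M.Cfg} {G : Tape (Sym N)} {b : Bool}
    (h : M.due c = .halt b) : (M.oracle e d γ ok).Runs c.state (M.oracleTapes e c G) [] 0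
      (M.oracleTapes e c G) (b && ok G.head) := by
  refine .halt ?_
  simp only [oracle, due_eq M hd, h]
  rfl

theorem oracle_move (hd : ∀ γ, d (e γ) = γ) {c : M.Cfg} {G : Tape (Sym N)}
    {m : Move M.K M.Γ M.Q} (h : M.due c = .move m) {n : ℕ} {T' : Option M.K → Tape (Sym N)}
    {b : Bool} (hr : (M.oracle e d γ ok).Runs (M.apply m c).state
      (M.oracleTapes e (M.apply m c) G) [] n T' b) :
    (M.oracle e d γ ok).Runs c.state (M.oracleTapes e c G) [] (n + 1) T' b := by
  have hact := M.act_extendMove e m G.head none c G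
  rw [Option.elim_none, write_head] at hact
  rw [← hact] at hr
  refine Core.Runs.move (C := M.oracle e d γ ok) (m := M.extendMove e m G.head none) ?_ hr
  simp only [oracle, due_eq M hd, h]
  rfl

theorem oracle_guess (hd : ∀ γ, d (e γ) = γ) {c : M.Cfg} {G : Tape (Sym N)}
    {m : Bool → Move M.K M.Γ M.Q} (h : M.due c = .guess m) {n : ℕ}
    {T' : Option M.K → Tape (Sym N)} {b b' : Bool} {g : Sym N} (hγ : γ G.head = some (b', g))
    (hr : (M.oracle e d γ ok).Runs (M.apply (m b') c).state
      (M.oracleTapes e (M.apply (m b') c) ((G.write g).move Dir.right)) [] n T' b) :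
    (M.oracle e d γ ok).Runs c.state (M.oracleTapes e c G) [] (n + 1) T' b := by
  have hact := M.act_extendMove e (m b') g (some Dir.right) c G
  rw [Option.elim_some] at hact
  rw [← hact] at hr
  refine Core.Runs.move (C := M.oracle e d γ ok)
    (m := M.extendMove e (m b') g (some Dir.right)) ?_ hr
  simp only [oracle, due_eq M hd, h]
  simp [oracleTapes, hγ]

theorem oracle_guess_none (hd : ∀ γ, d (e γ) = γ) {c : M.Cfg} {G : Tape (Sym N)}
    {m : Bool → Move M.K M.Γ M.Q} (h : M.due c = .guess m) (hγ : γ G.head = none) :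
    (M.oracle e d γ ok).Runs c.state (M.oracleTapes e c G) [] 0 (M.oracleTapes e c G) false := by
  refine .halt ?_
  simp only [oracle, due_eq M hd, h]
  simp [oracleTapes, hγ]

/-! ### Guesses read from a tape, and guesses counted -/

/-- The control that works like `M` and reads its guesses from an additional tape. It accepts if `M`
accepts and all symbols on that tape have been read. -/
abbrev reader (M : NTM a) (e : PointedMap M.Γ (Sym N)) (d : Sym N → M.Γ) :
    Core (Option M.K) (Sym N) :=
  M.oracle e d (fun s => s.toBit.map fun b => (b, s)) fun s => s.toBit.isNone

/-- With the guesses supplied, the simulation is step by step. It ends with result `false` if the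
guesses run out too early, and also if symbols are left over, so acceptance means that `w` is
exactly an accepting path. The induction is on the step bound `B`; for `B = 0` the machine has to be
halting. -/
theorem reader_runs (hd : ∀ γ, d (e γ) = γ) : ∀ (B : ℕ) (c : M.Cfg) (L w : List Bool),
    (∀ w' n c', M.Steps c w' n c' → n ≤ B) →
    ∃ n ≤ B, ∃ T' b, (M.reader e d).Runs c.state (M.oracleTapes e c (btape L w)) [] n T' b ∧
      (b = true → ∃ n' c', M.Steps c w n' c' ∧ M.due c' = .halt true ∧
        ∀ k, T' (some k) = (c'.tapes k).map e) ∧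
      ((∃ n' c', M.Steps c w n' c' ∧ M.due c' = .halt true) → b = true) := by
  intro B
  induction B with
  | zero =>
    intro c L w hB
    rcases h : M.due c with b | m | m
    · refine ⟨0, le_rfl, _, _, oracle_halt hd h, ?_, ?_⟩
      · rcases w with _ | ⟨g, w⟩
        · simp only [btape_head_nil, Sym.toBit_none, Option.isNone_none, Bool.and_true]
          rintro rfl
          exact ⟨0, c, .refl c, h, fun k => rfl⟩
        · simp
      · rintro ⟨n', c', hs, hc'⟩
        cases hs with
        | refl => simp_all
        | move h' => simp_all
        | guess _ h' => simp_all
    · exact absurd (hB _ _ _ (.move h (.refl _))) (by simp)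
    · exact absurd (hB _ _ _ (.guess true h (.refl _))) (by simp)
  | succ B ih =>
    intro c L w hB
    rcases h : M.due c with b | m | m
    · refine ⟨0, by simp, _, _, oracle_halt hd h, ?_, ?_⟩
      · rcases w with _ | ⟨g, w⟩
        · simp only [btape_head_nil, Sym.toBit_none, Option.isNone_none, Bool.and_true]
          rintro rfl
          exact ⟨0, c, .refl c, h, fun k => rfl⟩
        · simp
      · rintro ⟨n', c', hs, hc'⟩
        cases hs with
        | refl => simp_all
        | move h' => simp_all
        | guess _ h' => simp_all
    · obtain ⟨n, hn, T', b, hr, h1, h2⟩ := ih (M.apply m c) L w fun w' n c' hs => by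
        have := hB _ _ _ (.move h hs); omega
      refine ⟨n + 1, by omega, T', b, oracle_move hd h hr, fun hb => ?_, ?_⟩
      · obtain ⟨n', c', hs, hc'⟩ := h1 hb
        exact ⟨n' + 1, c', .move h hs, hc'⟩
      · rintro ⟨n', c', hs, hc'⟩
        cases hs with
        | refl => simp_all
        | move h' hs =>
          rw [h] at h'; cases h'
          exact h2 ⟨_, _, hs, hc'⟩
        | guess _ h' => simp_all
    · rcases w with _ | ⟨g, w⟩
      · refine ⟨0, by simp, _, _, oracle_guess_none hd h rfl, by simp, ?_⟩
        rintro ⟨n', c', hs, hc'⟩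
        cases hs with
        | refl => simp_all
        | move h' => simp_all
      · obtain ⟨n, hn, T', b, hr, h1, h2⟩ := ih (M.apply (m g) c) (g :: L) w
          fun w' n c' hs => by
            have := hB _ _ _ (.guess g h hs); omega
        refine ⟨n + 1, by omega, T', b, oracle_guess (g := sbit g) (b' := g) hd h (by simp)
          (by simpa using hr), fun hb => ?_, ?_⟩
        · obtain ⟨n', c', hs, hc'⟩ := h1 hb
          exact ⟨n' + 1, c', .guess g h hs, hc'⟩
        · rintro ⟨n', c', hs, hc'⟩
          cases hs with
          | move h' => simp_all
          | guess _ h' hs =>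
            rw [h] at h'; cases h'
            exact h2 ⟨_, _, hs, hc'⟩

/-- The control that works like `M` when all guesses are zero, and writes a symbol on an additional
tape for each guess. -/
abbrev counter (M : NTM a) (e : PointedMap M.Γ (Sym N)) (d : Sym N → M.Γ) :
    Core (Option M.K) (Sym N) :=
  M.oracle e d (fun _ => some (false, sbit true)) fun _ => true

/-- The simulation answers every guess with zero, so it follows precisely the all-zero path and
leaves one mark per guess. -/
theorem counter_runs (hd : ∀ γ, d (e γ) = γ) {c c' : M.Cfg} {w : List Bool} {n : ℕ}
    (hs : M.Steps c w n c') {b : Bool} (hc' : M.due c' = .halt b) :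
    ∀ l L, w = List.replicate l false → ∃ T',
      (M.counter e d).Runs c.state (M.oracleTapes e c (btape L [])) [] n T' b ∧
      T' none = btape (List.replicate l true ++ L) [] := by
  induction hs with
  | refl c =>
    intro l L hl
    obtain rfl : l = 0 := by simpa using congrArg List.length hl.symm
    exact ⟨_, by simpa using oracle_halt (ok := fun _ => true) hd hc', rfl⟩
  | move h _ ih =>
    intro l L hl
    obtain ⟨T', hr, hT'⟩ := ih hc' l L hl
    exact ⟨T', oracle_move hd h hr, hT'⟩
  | guess g h _ ih =>
    intro l L hl
    rcases l with _ | l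
    · simp at hl
    rw [List.replicate_succ, List.cons.injEq] at hl
    obtain ⟨rfl, hl⟩ := hl
    obtain ⟨T', hr, hT'⟩ := ih hc' l (true :: L) hl
    refine ⟨T', oracle_guess (g := sbit true) (b' := false) hd h rfl (by simpa using hr), ?_⟩
    rw [hT', List.replicate_succ']
    simp

/-! ### Initial configurations in the common alphabet -/

theorem map_stringTape (hb : ∀ b, e (M.bit b) = sbit b) (w : List Bool) :
    (M.stringTape w).map e = str w := by
  rw [stringTape, Tape.map_mk₁, List.map_map]
  simp [Function.comp_def, hb, btape, Tape.mk₁]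

theorem map_tape_default : (default : Tape M.Γ).map e = default := by
  rw [tape_default, Tape.map_mk₂]
  rfl

theorem map_init_input (hb : ∀ b, e (M.bit b) = sbit b) (v : Fin a → List Bool) (i : Fin a) :
    ((M.init v).tapes (M.input i)).map e = str (v i) := by
  simp only [init, M.input.injective.extend_apply, map_stringTape hb]

theorem map_init_of_ne (v : Fin a → List Bool) {k : M.K} (hk : ∀ i, M.input i ≠ k) :
    ((M.init v).tapes k).map e = default := by
  simp only [init, Function.extend_apply' _ _ _ fun ⟨i, hi⟩ => hk i hi, map_tape_default]

theorem oracleTapes_init (hb : ∀ b, e (M.bit b) = sbit b) (v : Fin a → List Bool) :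
    M.oracleTapes e (M.init v) (str []) = initTapes (M.input.trans .some) v := by
  funext κ
  rcases κ with _ | k
  · exact (initTapes_of_ne _ _ (by simp)).symm
  · by_cases hk : ∃ i, M.input i = k
    · obtain ⟨i, rfl⟩ := hk
      exact (map_init_input hb v i).trans (initTapes_inp (M.input.trans .some) v i).symm
    · push Not at hk
      exact (map_init_of_ne v hk).trans (initTapes_of_ne _ _ (by simpa using hk)).symm

/-- The input tapes of the reader: the input tape of the machine and the tape with the guesses. -/
def readerInput (M : NTM 1) : Fin 2 ↪ Option M.K :=
  ⟨![some (M.input 0), none], by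
    intro i j h
    fin_cases i <;> fin_cases j <;> simp_all⟩

theorem oracleTapes_init_reader {M : NTM 1} {e : PointedMap M.Γ (Sym N)}
    (hb : ∀ b, e (M.bit b) = sbit b) (v : Fin 2 → List Bool) :
    M.oracleTapes e (M.init fun _ => v 0) (str (v 1)) = initTapes M.readerInput v := by
  funext κ
  rcases κ with _ | k
  · exact (initTapes_inp M.readerInput v 1).symm
  · by_cases hk : M.input 0 = k
    · subst hk
      exact (map_init_input hb _ 0).trans (initTapes_inp M.readerInput v 0).symm
    · refine (map_init_of_ne _ ?_).trans (initTapes_of_ne _ _ ?_).symm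
      · simpa [Fin.forall_fin_one] using hk
      · rw [Fin.forall_fin_two]
        exact ⟨fun h => hk (Option.some_injective _ h), fun h => by cases h⟩

end NTM

/-- The control that writes a one on the tape `a`. -/
def Core.writeOne {K : Type} {N : ℕ} [DecidableEq K] (a : K) : Core K (Sym N) where
  Q := Bool
  finQ := inferInstance
  start := false
  instr q s := if q then .halt true else .move ⟨true, Function.update s a (sbit true), fun _ => none⟩

theorem Core.writeOne_det {K : Type} {N : ℕ} [DecidableEq K] (a : K) :
    (writeOne a : Core K (Sym N)).Det := by
  intro q s m h
  change Bool at q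
  cases q <;> simp [writeOne] at h

theorem Core.writeOne_runs {K : Type} {N : ℕ} [DecidableEq K] (a : K) (T : K → Tape (Sym N))
    (hT : T a = default) : ∃ T', (writeOne a : Core K (Sym N)).Runs (writeOne a).start T [] 1 T' true ∧
      T' a = str [true] := by
  refine ⟨_, Runs.move (C := writeOne a) rfl (Runs.halt rfl), ?_⟩
  simp [Move.act, hT]

/-- A function is computable in polynomial time if some control runs in polynomial time and the
output can then be produced by another control, or is empty, according to the result. -/
theorem FP.of_core {k : ℕ} {f : (Fin k → List Bool) → List Bool} (r : Polynomial ℕ)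
    (hlen : ∀ v, (f v).length ≤ r.eval (size v)) (N₀ : ℕ)
    (h : ∀ N ≥ N₀, ∃ (K : Type) (_ : Finite K) (C : Core K (Sym N)) (inp : Fin k ↪ K)
      (E : Core (Option K) (Sym N)), C.Det ∧ E.Det ∧ ∀ v, ∃ n ≤ r.eval (size v), ∃ T b,
        C.Runs C.start (initTapes inp v) [] n T b ∧ (b = false → f v = []) ∧
        (b = true → ∀ T₁, (∀ κ, T₁ (some κ) = T κ) → T₁ none = default →
          ∃ n' ≤ r.eval (size v), ∃ T' b', E.Runs E.start T₁ [] n' T' b' ∧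
            T' none = str (f v))) : FP f := by
  refine ⟨2 * r, fun v => (hlen v).trans (by simp; omega), N₀, fun N hN => ?_⟩
  obtain ⟨K, _, C, inp, E, hC, hE, h⟩ := h N hN
  refine ⟨Option K, inferInstance, (C.embed .some).bind fun b => if b then E else Core.done true,
    inp.trans .some, none, (hC.embed _).bind ?_, fun v => ?_⟩
  · rintro (_ | _)
    · exact Core.done_det _
    · exact hE
  obtain ⟨n, hn, T, b, hr, h0, h1⟩ := h v
  have hr' := hr.embed' .some (initTapes (inp.trans .some) v) (fun κ => by
    by_cases hκ : ∃ i, inp i = κ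
    · obtain ⟨i, rfl⟩ := hκ
      exact (initTapes_inp (inp.trans .some) v i).trans (initTapes_inp _ _ _).symm
    · push Not at hκ
      rw [initTapes_of_ne _ _ hκ, initTapes_of_ne _ _ (by simpa using hκ)])
  have hnone : Function.extend (Function.Embedding.some : K ↪ Option K) T
      (initTapes (inp.trans .some) v) none = default := by
    rw [Function.extend_apply' _ _ _ (by simp), initTapes_of_ne _ _ (by simp)]
  cases b with
  | false =>
    refine ⟨n + 0, by simp; omega, _, _, Core.Runs.bind hr' (Core.done_runs _ _), ?_⟩
    rw [hnone, h0 rfl]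
    rfl
  | true =>
    obtain ⟨n', hn', T', b', hr'', hT'⟩ := h1 rfl _
      (fun κ => Function.Embedding.some.injective.extend_apply _ _ κ) hnone
    exact ⟨n + n', by simp; omega, _, _, Core.Runs.bind hr' hr'', hT'⟩

/-! ### Acceptance, output and number of guesses as polynomial-time functions -/

namespace NTM

theorem mem_acc_iff {a : ℕ} {M : NTM a} {v : Fin a → List Bool} {w : List Bool} :
    w ∈ M.acc v ↔ ∃ n c, M.Steps (M.init v) w n c ∧ M.due c = .halt true :=
  ⟨fun ⟨c, ⟨n, hs⟩, hc⟩ => ⟨n, c, hs, hc⟩, fun ⟨n, c, hs, hc⟩ => ⟨c, ⟨n, hs⟩, hc⟩⟩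

open Classical in
-- Checking a given path needs no guessing: the reader does it within the time bound of `M`.
theorem fp_accepts {M : NTM 1} (hM : M.PolyTime) {k : ℕ}
    {f g : (Fin k → List Bool) → List Bool} (hf : FP f) (hg : FP g) :
    FP fun v => if g v ∈ M.acc (fun _ => f v) then [true] else [] := by
  have : FP fun v : Fin 2 → List Bool => if v 1 ∈ M.acc (fun _ => v 0) then [true] else [] := by
    obtain ⟨r, hr⟩ := hM
    obtain ⟨N₀, hN⟩ := M.exists_encoding
    refine FP.of_core (r + 1) (fun v => by split <;> simp) N₀ fun N hN' => ?_
    obtain ⟨e, d, hd, hb⟩ := hN N hN'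
    have := M.finK
    refine ⟨_, inferInstance, M.reader e d, M.readerInput, Core.writeOne none, M.oracle_det _ _ _ _,
      Core.writeOne_det _, fun v => ?_⟩
    obtain ⟨n, hn, T', b, hrun, h1, h2⟩ := reader_runs hd (r.eval (v 0).length)
      (M.init fun _ => v 0) [] (v 1) (fun w' n c' hs => by simpa using hr _ _ _ _ hs)
    have hmono := eval_mono r (length_le_size v 0)
    simp only at hmono
    refine ⟨n, by simp; omega, T', b, oracleTapes_init_reader hb v ▸ hrun, ?_, ?_⟩
    · rintro rfl
      refine if_neg fun h => ?_
      simpa using h2 (mem_acc_iff.1 h)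
    · rintro rfl T₁ - hT₁
      obtain ⟨n', c', hs, hc', -⟩ := h1 rfl
      obtain ⟨T₂, hr₂, hT₂⟩ := Core.writeOne_runs (none : Option (Option M.K)) T₁ hT₁
      exact ⟨1, by simp, T₂, true, hr₂, by rw [hT₂, if_pos (mem_acc_iff.2 ⟨n', c', hs, hc'⟩)]⟩
  exact this.comp₂ hf hg

open Classical in
-- A simulation along an accepting path ends with `F` of the input on the output tape, from where it
-- is copied. This is how a value of a `UPSVt` function is found once its path is known.
theorem fp_output {M : NTM 1} (hM : M.PolyTime) {F : List Bool → List Bool}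
    (hF : ∀ x w c, M.Halts (fun _ => x) w c true → M.Outputs c (F x)) {s : Polynomial ℕ}
    (hs : ∀ x, (F x).length ≤ s.eval x.length) {k : ℕ}
    {f g : (Fin k → List Bool) → List Bool} (hf : FP f) (hg : FP g) :
    FP fun v => if g v ∈ M.acc (fun _ => f v) then F (f v) else [] := by
  have : FP fun v : Fin 2 → List Bool => if v 1 ∈ M.acc (fun _ => v 0) then F (v 0) else [] := by
    obtain ⟨r, hr⟩ := hM
    obtain ⟨N₀, hN⟩ := M.exists_encoding
    have hs' : ∀ v : Fin 2 → List Bool, (F (v 0)).length ≤ s.eval (size v) := fun v =>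
      (hs _).trans (eval_mono s (length_le_size v 0))
    refine FP.of_core (r + 2 * s + 2) (fun v => ?_) N₀ fun N hN' => ?_
    · have := hs' v
      split <;> simp
      omega
    obtain ⟨e, d, hd, hb⟩ := hN N hN'
    have := M.finK
    refine ⟨_, inferInstance, M.reader e d, M.readerInput, Core.copy (some (some M.output)) {none},
      M.oracle_det _ _ _ _, Core.copy_det _ _, fun v => ?_⟩
    obtain ⟨n, hn, T', b, hrun, h1, h2⟩ := reader_runs hd (r.eval (v 0).length)
      (M.init fun _ => v 0) [] (v 1) (fun w' n c' hs => by simpa using hr _ _ _ _ hs)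
    have hmono := eval_mono r (length_le_size v 0)
    simp only at hmono
    refine ⟨n, by simp; omega, T', b, oracleTapes_init_reader hb v ▸ hrun, ?_, ?_⟩
    · rintro rfl
      refine if_neg fun h => ?_
      simpa using h2 (mem_acc_iff.1 h)
    · rintro rfl T₁ hT₁' hT₁
      obtain ⟨n', c', hs, hc', hT'⟩ := h1 rfl
      have hout : M.Outputs c' (F (v 0)) := hF _ _ _ ⟨⟨n', hs⟩, hc'⟩
      refine ⟨_, ?_, _, _, Core.copy_runs (by simp) (F (v 0)) T₁ ?_ (by simpa using hT₁), ?_⟩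
      · have := hs' v
        simp; omega
      · rw [hT₁', hT', hout, map_stringTape hb]
      · rw [if_pos (Set.mem_singleton _), if_pos (mem_acc_iff.2 ⟨n', c', hs, hc'⟩)]
  exact this.comp₂ hf hg

theorem Steps.length_le {a : ℕ} {M : NTM a} {c c' : M.Cfg} {w : List Bool} {n : ℕ}
    (hs : M.Steps c w n c') : w.length ≤ n := by
  induction hs with
  | refl => simp
  | move _ _ ih => omega
  | guess _ _ _ ih => simpa using ih

/-- Since `M` is balanced, its all-zero path exists and has exactly `p(|x|)` guesses, so following
it and counting yields `p(|x|)` in unary. No arithmetic with the rational coefficients of `p` is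
needed. -/
theorem fp_guesses {M : NTM 1} (hM : M.PolyTime) {p : ℕ → ℕ} (hp : M.Balanced p) {k : ℕ}
    {f : (Fin k → List Bool) → List Bool} (hf : FP f) :
    FP fun v => List.replicate (p (f v).length) true := by
  have : FP fun v : Fin 1 → List Bool => List.replicate (p (v 0).length) true := by
    obtain ⟨r, hr⟩ := hM
    obtain ⟨N₀, hN⟩ := M.exists_encoding
    have hsteps : ∀ v : Fin 1 → List Bool, ∃ n c b,
        M.Steps (M.init v) (List.replicate (p (v 0).length) false) n c ∧ M.due c = .halt b := by
      intro v
      have : List.replicate (p (v 0).length) false ∈ M.paths fun _ => v 0 := by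
        rw [hp]; simp [strings]
      obtain ⟨c, b, ⟨n, hs⟩, hc⟩ := this
      have hv : (fun _ => v 0) = v := by funext i; fin_cases i; rfl
      exact ⟨n, c, b, hv ▸ hs, hc⟩
    have hpr : ∀ v : Fin 1 → List Bool, p (v 0).length ≤ r.eval (size v) := fun v => by
      obtain ⟨n, c, b, hs, -⟩ := hsteps v
      have := hs.length_le.trans (hr _ _ _ _ hs)
      rwa [List.length_replicate] at this
    refine ⟨2 * r + 2, fun v => ?_, N₀, fun N hN' => ?_⟩
    · have := hpr v
      simp; omega
    obtain ⟨e, d, hd, hb⟩ := hN N hN'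
    have := M.finK
    refine ⟨Option M.K, inferInstance, (M.counter e d).bind fun _ => Core.rewind none {none},
      M.input.trans .some, none, (M.oracle_det _ _ _ _).bind fun _ => Core.rewind_det _ _,
      fun v => ?_⟩
    obtain ⟨n, c, b, hs, hc⟩ := hsteps v
    obtain ⟨T', hr', hT'⟩ := counter_runs (e := e) hd hs hc (p (v 0).length) [] rfl
    rw [oracleTapes_init hb] at hr'
    have h2 := Core.rewind_runs (S := {none}) (Set.mem_singleton none) _ T' (by
      simpa using hT')
    refine ⟨_, ?_, _, _, Core.Runs.bind (D := fun _ => Core.rewind none {none}) hr' h2, ?_⟩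
    · have h3 := hpr v
      have h4 := hr _ _ _ _ hs
      change n ≤ r.eval (size v) at h4
      simp; omega
    · simp
  exact this.comp₁ hf

end NTM

open Classical in
-- With an empty guess tape, the reader accepts exactly when the empty path does.
theorem fp_of_pTimePred₃ {R : List Bool → List Bool → List Bool → Prop} (hR : R ∈ PTimePred₃)
    {k : ℕ} {f₁ f₂ f₃ : (Fin k → List Bool) → List Bool} (h₁ : FP f₁) (h₂ : FP f₂) (h₃ : FP f₃) :
    FP fun v => if R (f₁ v) (f₂ v) (f₃ v) then [true] else [] := by
  have : FP fun v : Fin 3 → List Bool => if R (v 0) (v 1) (v 2) then [true] else [] := by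
    obtain ⟨M, -, ⟨r, hr⟩, hM⟩ := hR
    obtain ⟨N₀, hN⟩ := M.exists_encoding
    refine FP.of_core (r + 1) (fun v => by split <;> simp) N₀ fun N hN' => ?_
    obtain ⟨e, d, hd, hb⟩ := hN N hN'
    have := M.finK
    refine ⟨_, inferInstance, M.reader e d, M.input.trans .some, Core.writeOne none,
      M.oracle_det _ _ _ _, Core.writeOne_det _, fun v => ?_⟩
    have hv : v = ![v 0, v 1, v 2] := by funext i; fin_cases i <;> rfl
    obtain ⟨n, hn, T', b, hrun, h1, h2⟩ := NTM.reader_runs hd (r.eval (size v))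
      (M.init v) [] [] (fun w' n c' hs => hr _ _ _ _ hs)
    refine ⟨n, by simp; omega, T', b, NTM.oracleTapes_init hb v ▸ hrun, ?_, ?_⟩
    · rintro rfl
      refine if_neg fun h => ?_
      rw [hM, ← hv] at h
      simpa using h2 (NTM.mem_acc_iff.1 h)
    · rintro rfl T₁ - hT₁
      obtain ⟨n', c', hs, hc', -⟩ := h1 rfl
      obtain ⟨T₂, hr₂, hT₂⟩ := Core.writeOne_runs (none : Option (Option M.K)) T₁ hT₁
      refine ⟨1, by simp, T₂, true, hr₂, ?_⟩
      rw [hT₂, if_pos]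
      rw [hM, ← hv]
      exact NTM.mem_acc_iff.2 ⟨n', c', hs, hc'⟩
  exact this.comp₃ h₁ h₂ h₃

end CLU

namespace CLU

open Turing

/-! ### Machines from controls -/

namespace NTM

variable {a : ℕ} {M : NTM a}

/-- A computation that halts determines all computations whose guesses are comparable. -/
theorem Steps.compare {c c' : M.Cfg} {w : List Bool} {n : ℕ} {b : Bool} (hs : M.Steps c w n c')
    (hc' : M.due c' = .halt b) : ∀ {w₂ : List Bool} {n₂ : ℕ} {c₂ : M.Cfg}, M.Steps c w₂ n₂ c₂ →
      (w <+: w₂ ∨ w₂ <+: w) → n₂ ≤ n ∧ ∀ b₂, M.due c₂ = .halt b₂ → w₂ = w ∧ c₂ = c' := by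
  induction hs with
  | refl c =>
    intro w₂ n₂ c₂ hs₂ _
    cases hs₂ with
    | refl => exact ⟨le_rfl, fun _ _ => ⟨rfl, rfl⟩⟩
    | move h => simp_all
    | guess _ h => simp_all
  | @move c c' m w n h _ ih =>
    intro w₂ n₂ c₂ hs₂ hw
    cases hs₂ with
    | refl => exact ⟨by simp, fun _ _ => by simp_all⟩
    | move h' hs₂ =>
      rw [h] at h'; cases h'
      obtain ⟨h1, h2⟩ := ih hc' hs₂ hw
      exact ⟨by omega, h2⟩
    | guess _ h' => simp_all
  | @guess c c' m w n g h _ ih =>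
    intro w₂ n₂ c₂ hs₂ hw
    cases hs₂ with
    | refl => exact ⟨by simp, fun _ _ => by simp_all⟩
    | move h' => simp_all
    | guess g' h' hs₂ =>
      rw [h] at h'; cases h'
      simp only [List.cons_prefix_cons] at hw
      obtain rfl : g = g' := by rcases hw with ⟨h, _⟩ | ⟨h, _⟩ <;> simp [h]
      obtain ⟨h1, h2⟩ := ih hc' hs₂ (by simpa using hw)
      exact ⟨by omega, fun b₂ hb₂ => by simp [h2 b₂ hb₂]⟩

theorem Deterministic.eq_nil (hM : M.Deterministic) {c c' : M.Cfg} {w : List Bool} {n : ℕ}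
    (hs : M.Steps c w n c') : w = [] := by
  induction hs with
  | refl => rfl
  | move _ _ ih => exact ih
  | guess _ h _ _ => exact absurd h (hM _ _ _)

/-- The empty guess string is a prefix of every other, so by `Steps.compare` no computation outlasts
the given halting one. -/
theorem Deterministic.polyTime (_hM : M.Deterministic) (r : Polynomial ℕ)
    (h : ∀ v : Fin a → List Bool, ∃ n ≤ r.eval (size v), ∃ c b,
      M.Steps (M.init v) [] n c ∧ M.due c = .halt b) : M.PolyTime := by
  refine ⟨r, fun v w n c hs => ?_⟩
  obtain ⟨n', hn', c', b, hs', hc'⟩ := h v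
  exact (hs'.compare hc' hs (by simp)).1.trans hn'

theorem exists_prefix (w : List Bool) (n : ℕ) :
    ∃ w' ∈ strings n, w' <+: w ∨ w <+: w' := by
  rcases le_total w.length n with h | h
  · exact ⟨w ++ List.replicate (n - w.length) true, by simp [strings, h],
      Or.inr (List.prefix_append _ _)⟩
  · exact ⟨w.take n, by simp [strings, h], Or.inl (List.take_prefix _ _)⟩

/-- Every guess string is comparable with one of length `q(|x|)`, on which the computation is known
to halt; by `Steps.compare` there are no further halting paths and no longer computations. -/
theorem balanced_of_steps {M : NTM 1} {q : ℕ → ℕ} (r : Polynomial ℕ)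
    {A : List Bool → Set (List Bool)}
    (h : ∀ x, ∀ w ∈ strings (q x.length), ∃ n ≤ r.eval x.length, ∃ c b,
      M.Steps (M.init fun _ => x) w n c ∧ M.due c = .halt b ∧ (b = true ↔ w ∈ A x)) :
    M.PolyTime ∧ M.Balanced q ∧ ∀ x, M.acc (fun _ => x) = {w | w ∈ strings (q x.length) ∧ w ∈ A x} := by
  have key : ∀ x w n c, M.Steps (M.init fun _ => x) w n c → n ≤ r.eval x.length ∧
      ∀ b, M.due c = .halt b → w ∈ strings (q x.length) ∧ (b = true ↔ w ∈ A x) := by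
    intro x w n c hs
    obtain ⟨w', hw', hp⟩ := exists_prefix w (q x.length)
    obtain ⟨n', hn', c', b', hs', hc', hb'⟩ := h x w' hw'
    obtain ⟨h1, h2⟩ := hs'.compare hc' hs hp
    refine ⟨h1.trans hn', fun b hb => ?_⟩
    obtain ⟨rfl, rfl⟩ := h2 b hb
    rw [hc', Instr.halt.injEq] at hb
    exact ⟨hw', hb ▸ hb'⟩
  refine ⟨⟨r, fun v w n c hs => ?_⟩, fun x => ?_, fun x => ?_⟩
  · have hv : v = fun _ => v 0 := by funext i; fin_cases i; rfl
    rw [hv] at hs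
    simpa using (key _ _ _ _ hs).1
  · ext w
    constructor
    · rintro ⟨c, b, ⟨n, hs⟩, hc⟩
      exact ((key _ _ _ _ hs).2 b hc).1
    · intro hw
      obtain ⟨n, -, c, b, hs, hc, -⟩ := h x w hw
      exact ⟨c, b, ⟨n, hs⟩, hc⟩
  · ext w
    constructor
    · rintro ⟨c, ⟨n, hs⟩, hc⟩
      obtain ⟨h1, h2⟩ := (key _ _ _ _ hs).2 true hc
      exact ⟨h1, h2.1 rfl⟩
    · rintro ⟨hw, hA⟩
      obtain ⟨n, -, c, b, hs, hc, hb⟩ := h x w hw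
      obtain rfl := hb.2 hA
      exact ⟨c, ⟨n, hs⟩, hc⟩

/-- The machine in which all halting computations of `M` accept. -/
def acceptAll (M : NTM a) : NTM a where
  __ := M
  instr q s := match M.instr q s with
    | .halt _ => .halt true
    | .move m => .move m
    | .guess m => .guess m

theorem acceptAll_steps {c c' : M.Cfg} {w : List Bool} {n : ℕ} (hs : M.Steps c w n c') :
    M.acceptAll.Steps ⟨c.state, c.tapes⟩ w n ⟨c'.state, c'.tapes⟩ := by
  induction hs with
  | refl => exact .refl _
  | @move c c' m w n h _ ih =>
    refine .move (M := M.acceptAll) (m := m) ?_ ih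
    simp only [due, acceptAll] at h ⊢
    rw [h]
  | @guess c c' m w n g h _ ih =>
    refine .guess (M := M.acceptAll) (m := m) g ?_ ih
    simp only [due, acceptAll] at h ⊢
    rw [h]

end NTM

/-! ### The easy inclusion -/

/-- A machine for a function in `FPt` may also halt rejecting, hence the passage to `acceptAll`;
determinism leaves the empty string as the only path. -/
theorem fpt_subset_upsvt : FPt ⊆ UPSVt := by
  rintro f ⟨M, hdet, ⟨r, hr⟩, hf⟩
  have hdet' : M.acceptAll.Deterministic := by
    intro q s m h
    simp only [NTM.acceptAll] at h
    split at h <;> simp_all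
    exact hdet _ _ _ ‹_›
  have hrun : ∀ x, ∃ n ≤ r.eval x.length, ∃ c, M.acceptAll.Steps
      (M.acceptAll.init fun _ => x) [] n c ∧ M.acceptAll.due c = .halt true ∧
        M.acceptAll.Outputs c (f x) := by
    intro x
    obtain ⟨c, b, ⟨⟨n, hs⟩, hc⟩, ho⟩ := hf x
    refine ⟨n, by simpa using hr _ _ _ _ hs, _, NTM.acceptAll_steps hs, ?_, ho⟩
    simp only [NTM.due, NTM.acceptAll] at hc ⊢
    rw [hc]
  refine ⟨M.acceptAll, hdet'.polyTime r fun v => ?_, fun x => ⟨?_, ?_, ?_⟩⟩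
  · obtain ⟨n, hn, c, hs, hc, -⟩ := hrun (v 0)
    have hv : (fun _ => v 0) = v := by funext i; fin_cases i; rfl
    exact ⟨n, by simpa [size] using hn, c, true, hv ▸ hs, hc⟩
  · rintro w ⟨c, ⟨n, hs⟩, -⟩ w' ⟨c', ⟨n', hs'⟩, -⟩
    rw [hdet'.eq_nil hs, hdet'.eq_nil hs']
  · rintro w c ⟨⟨n, hs⟩, hc⟩
    obtain ⟨n', -, c', hs', hc', ho⟩ := hrun x
    obtain ⟨-, rfl⟩ := (hs'.compare hc' hs (by simp)).2 _ hc
    exact ⟨f x, by simp, ho⟩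
  · intro h
    obtain ⟨n', -, c', hs', hc', ho⟩ := hrun x
    have hmem : [] ∈ M.acceptAll.acc fun _ => x := ⟨c', ⟨n', hs'⟩, hc'⟩
    rw [h] at hmem
    exact hmem.elim

/-! ### From controls back to machines -/

namespace Core

variable {K : Type} {N a : ℕ}

/-- The machine with a given control. -/
def toNTM [Finite K] (C : Core K (Sym N)) (inp : Fin a ↪ K) (out : K) : NTM a where
  K := K
  Γ := Sym N
  Q := C.Q
  finK := inferInstance
  finΓ := inferInstance
  finQ := C.finQ
  blank := inferInstance
  bit := sbit
  bit_injective := sbit_injective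
  bit_ne_blank b := by simp
  input := inp
  output := out
  start := C.start
  instr := C.instr

theorem toNTM_steps [Finite K] {C : Core K (Sym N)} (inp : Fin a ↪ K) (out : K) {q : C.Q}
    {T T' : K → Tape (Sym N)} {w : List Bool} {n : ℕ} {b : Bool} (h : C.Runs q T w n T' b) :
    ∃ c, (C.toNTM inp out).Steps ⟨q, T⟩ w n c ∧ (C.toNTM inp out).due c = .halt b ∧
      c.tapes = T' := by
  induction h with
  | @halt q T b h => exact ⟨⟨q, T⟩, .refl _, h, rfl⟩
  | move h _ ih =>
    obtain ⟨c, hs, hc⟩ := ih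
    exact ⟨c, .move (M := C.toNTM inp out) h hs, hc⟩
  | guess g h _ ih =>
    obtain ⟨c, hs, hc⟩ := ih
    exact ⟨c, .guess (M := C.toNTM inp out) g h hs, hc⟩

theorem toNTM_deterministic [Finite K] {C : Core K (Sym N)} (hC : C.Det) (inp : Fin a ↪ K)
    (out : K) : (C.toNTM inp out).Deterministic := hC

/-- The control that accepts if the tape `a` is not blank. -/
def test (a : K) : Core K (Sym N) where
  Q := Unit
  finQ := inferInstance
  start := ()
  instr _ s := .halt (s a).isSome

theorem test_det (a : K) : (test a : Core K (Sym N)).Det := by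
  intro q s m h
  simp [test] at h

theorem test_runs {a : K} {T : K → Tape (Sym N)} {w : List Bool} (hT : T a = str w) :
    (test a : Core K (Sym N)).Runs (test a).start T [] 0 T (decide (w ≠ [])) := by
  refine .halt ?_
  rcases w with _ | ⟨b, w⟩ <;> simp [test, hT]
  rfl

end Core

theorem fpt_of_fp {f : (Fin 1 → List Bool) → List Bool} (hf : FP f) : (fun x => f fun _ => x) ∈ FPt := by
  obtain ⟨r, -, N, h⟩ := hf
  obtain ⟨K, _, C, inp, out, hC, h⟩ := h N le_rfl
  have hdet := Core.toNTM_deterministic hC inp out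
  refine ⟨C.toNTM inp out, hdet, hdet.polyTime r fun v => ?_, fun x => ?_⟩
  · obtain ⟨n, hn, T, b, hr, -⟩ := h v
    obtain ⟨c, hs, hc, -⟩ := Core.toNTM_steps inp out hr
    exact ⟨n, hn, c, b, hs, hc⟩
  · obtain ⟨n, -, T, b, hr, hT⟩ := h fun _ => x
    obtain ⟨c, hs, hc, rfl⟩ := Core.toNTM_steps inp out hr
    exact ⟨c, b, ⟨⟨n, hs⟩, hc⟩, hT⟩

/-- The output head ends on the first symbol, so one look at it tells whether the output is
nonempty. -/
theorem pTimePred₃_of_fp {f : (Fin 3 → List Bool) → List Bool} (hf : FP f) :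
    (fun x y z => f ![x, y, z] ≠ []) ∈ PTimePred₃ := by
  obtain ⟨r, -, N, h⟩ := hf
  obtain ⟨K, _, C, inp, out, hC, h⟩ := h N le_rfl
  have hdet := Core.toNTM_deterministic (hC.bind fun _ => Core.test_det out) inp out
  have hrun : ∀ v, ∃ n ≤ r.eval (size v), ∃ c,
      ((C.bind fun _ => Core.test out).toNTM inp out).Steps
        (((C.bind fun _ => Core.test out).toNTM inp out).init v) [] n c ∧
      ((C.bind fun _ => Core.test out).toNTM inp out).due c = .halt (decide (f v ≠ [])) := by
    intro v
    obtain ⟨n, hn, T, b, hr, hT⟩ := h v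
    obtain ⟨c, hs, hc, -⟩ := Core.toNTM_steps inp out
      (Core.Runs.bind (D := fun _ => Core.test out) hr (Core.test_runs hT))
    exact ⟨n, hn, c, hs, hc⟩
  refine ⟨_, hdet, hdet.polyTime r fun v => ?_, fun x y z => ?_⟩
  · obtain ⟨n, hn, c, hs, hc⟩ := hrun v
    exact ⟨n, hn, c, _, hs, hc⟩
  · obtain ⟨n, hn, c, hs, hc⟩ := hrun ![x, y, z]
    constructor
    · intro hf
      rw [decide_eq_true hf] at hc
      exact ⟨c, ⟨n, hs⟩, hc⟩
    · rintro ⟨c', ⟨n', hs'⟩, hc'⟩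
      obtain ⟨-, rfl⟩ := (hs.compare hc hs' (by simp)).2 _ hc'
      rw [hc, Instr.halt.injEq] at hc'
      exact of_decide_eq_true hc'

/-! ### Balanced machines -/

namespace Core

variable {K : Type} {N : ℕ}

open Classical in
/-- Guess a bit for each symbol on the tape `a` and write these bits on the tape `t`. -/
noncomputable def guessing (a t : K) : Core K (Sym N) where
  Q := Unit
  finQ := inferInstance
  start := ()
  instr _ s := if s a = none then .halt true else .guess fun b =>
    ⟨(), Function.update s t (sbit b), fun k => if k = a ∨ k = t then some Dir.right else none⟩

open Classical in
theorem guessing_runs {a t : K} (hat : a ≠ t) : ∀ (w R L L' : List Bool) (T : K → Tape (Sym N)),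
    w.length = R.length → T a = btape L R → T t = btape L' [] →
    ∃ T', (guessing a t).Runs () T w w.length T' true ∧ T' t = btape (w.reverse ++ L') [] ∧
      ∀ k, k ≠ a → k ≠ t → T' k = T k
  | [], [], L, L', T, _, ha, ht =>
    ⟨T, .halt (if_pos (by simp [ha])), by simpa using ht, fun _ _ _ => rfl⟩
  | b :: w, c :: R, L, L', T, hw, ha, ht => by
    let m : Bool → Move K (Sym N) Unit := fun b =>
      ⟨(), Function.update (fun k => (T k).head) t (sbit b),
        fun k => if k = a ∨ k = t then some Dir.right else none⟩
    obtain ⟨T', hr, hT', hk⟩ := guessing_runs hat w R (c :: L) (b :: L') ((m b).act T)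
      (by simpa using hw) (by simp [m, Move.act, ha, hat]) (by simp [m, Move.act, ht])
    refine ⟨T', Runs.guess (C := guessing a t) (m := m) b ?_ hr, by simp [hT'], fun k hka hkt => ?_⟩
    · exact if_neg (by simp [ha])
    · rw [hk k hka hkt]
      simp [m, Move.act, hka, hkt]

end Core

/-- A machine that guesses a string of a given length and then decides whether to accept. -/
theorem exists_balanced {q : ℕ → ℕ}
    (hq : FP fun v : Fin 1 → List Bool => List.replicate (q (v 0).length) true)
    {V : (Fin 2 → List Bool) → List Bool} (hV : FP V) :
    ∃ M : NTM 1, M.PolyTime ∧ M.Balanced q ∧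
      ∀ x, M.acc (fun _ => x) = {w | w ∈ strings (q x.length) ∧ V ![x, w] ≠ []} := by
  classical
  obtain ⟨rq, hlq, Nq, hq⟩ := hq
  obtain ⟨rv, -, Nv, hV⟩ := hV
  obtain ⟨Kq, _, Cq, inpq, outq, -, hq⟩ := hq (max Nq Nv) (le_max_left _ _)
  obtain ⟨Kv, _, Cv, inpv, outv, -, hV⟩ := hV (max Nq Nv) (le_max_right _ _)
  let eq : Kq ↪ Option (Kq ⊕ Kv) := ⟨fun k => some (.inl k), fun _ _ h => by simpa using h⟩
  let ev : Kv ↪ Option (Kq ⊕ Kv) := ⟨fun k => some (.inr k), fun _ _ h => by simpa using h⟩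
  have eq_def : ∀ k, eq k = some (.inl k) := fun _ => rfl
  have ev_def : ∀ k, ev k = some (.inr k) := fun _ => rfl
  let S : Set (Option (Kq ⊕ Kv)) := {eq (inpq 0), ev (inpv 0)}
  -- The input is copied to both subcomputations, `q(|x|)` is computed in unary, one bit per symbol
  -- of it is guessed directly onto the second input tape of `V`, and `V` is evaluated. Only the
  -- guessing phase guesses.
  let C : Core (Option (Kq ⊕ Kv)) (Sym (max Nq Nv)) :=
    (Core.copy none S).bind fun _ => (Cq.embed eq).bind fun _ =>
      (Core.guessing (eq outq) (ev (inpv 1))).bind fun _ =>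
        (Core.rewind (ev (inpv 1)) {ev (inpv 1)}).bind fun _ =>
          (Cv.embed ev).bind fun _ => Core.test (ev outv)
  let inp : Fin 1 ↪ Option (Kq ⊕ Kv) := ⟨fun _ => none, fun _ _ _ => Subsingleton.elim _ _⟩
  -- The time bound adds up the phases in order. Since `rq` also bounds the output length `q(|x|)`,
  -- it serves for guessing and rewinding, and `X + rq` bounds the size of the input of `V`.
  refine ⟨C.toNTM inp none, NTM.balanced_of_steps (A := fun x => {w | V ![x, w] ≠ []})
    (2 * Polynomial.X + 2 + rq + rq + (rq + 2) + rv.comp (Polynomial.X + rq)) fun x w hw => ?_⟩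
  have hw' : w.length = q x.length := hw
  let T₀ : Option (Kq ⊕ Kv) → Tape (Sym (max Nq Nv)) := initTapes inp fun _ => x
  have hT₀ : ∀ k, T₀ (some k) = default := fun k => initTapes_of_ne _ _ (by simp [inp])
  obtain ⟨T₁, hr₁, hT₁, hT₁'⟩ : ∃ T₁, (Core.copy none S).Runs (Core.copy none S).start T₀ []
      (2 * x.length + 2) T₁ true ∧ (∀ k ∈ S, T₁ k = str x) ∧ ∀ k ∉ S, T₁ k = T₀ k := by
    refine ⟨_, Core.copy_runs (by simp [S, eq_def, ev_def]) x T₀ (initTapes_inp inp _ 0) ?_,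
      fun k hk => if_pos hk, fun k hk => if_neg hk⟩
    rintro _ (rfl | rfl)
    · exact hT₀ _
    · exact hT₀ _
  obtain ⟨n₂, hn₂, T₂, b₂, hr₂, ho₂⟩ := hq fun _ => x
  have hr₂' := hr₂.embed' eq T₁ (fun k => by
    by_cases hk : inpq 0 = k
    · subst hk
      rw [initTapes_inp, hT₁ _ (Set.mem_insert _ _)]
    · rw [initTapes_of_ne _ _ (by simpa [Fin.forall_fin_one] using hk),
        hT₁' _ (by simpa [S, eq_def, ev_def] using Ne.symm hk)]
      exact hT₀ _)
  set T₂' := Function.extend eq T₂ T₁ with hT₂'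
  have hv₂ : ∀ k, T₂' (ev k) = T₁ (ev k) := fun k =>
    Function.extend_apply' _ _ _ (by simp [eq_def, ev_def])
  have hT₁v : ∀ k, k ≠ inpv 0 → T₁ (ev k) = default := fun k hk => by
    rw [hT₁' _ (by simpa [S, eq_def, ev_def] using hk)]
    exact hT₀ _
  have h10 : inpv 1 ≠ inpv 0 := fun h => by simpa using inpv.injective h
  obtain ⟨T₃, hr₃, ho₃, hT₃⟩ := Core.guessing_runs (a := eq outq) (t := ev (inpv 1))
    (by simp [eq_def, ev_def]) w (List.replicate (q x.length) true) [] [] T₂'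
    (by simp [hw']) (by rw [hT₂', eq.injective.extend_apply, ho₂]) (by
      rw [hv₂, hT₁v _ h10]; rfl)
  obtain ⟨T₄, hr₄, hT₄, hT₄'⟩ : ∃ T₄, (Core.rewind (ev (inpv 1)) {ev (inpv 1)}).Runs
      (Core.rewind (ev (inpv 1)) {ev (inpv 1)}).start T₃ [] (w.length + 2) T₄ true ∧
      T₄ (ev (inpv 1)) = str w ∧ ∀ k, k ≠ ev (inpv 1) → T₄ k = T₃ k := by
    have h := Core.rewind_runs (Set.mem_singleton (ev (inpv 1))) w.reverse T₃ (by
      simpa using ho₃)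
    rw [List.length_reverse] at h
    exact ⟨_, h, by simp, fun k hk => if_neg hk⟩
  obtain ⟨n₅, hn₅, T₅, b₅, hr₅, ho₅⟩ := hV ![x, w]
  have hr₅' := hr₅.embed' ev T₄ (fun k => by
    by_cases h1 : k = inpv 1
    · subst h1
      rw [hT₄, initTapes_inp]
      rfl
    · rw [hT₄' _ (by simpa [ev_def] using h1), hT₃ _ (by simp [eq_def, ev_def])
        (by simpa [ev_def] using h1), hv₂]
      by_cases h0 : k = inpv 0
      · subst h0
        rw [hT₁ _ (Set.mem_insert_of_mem _ rfl), initTapes_inp]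
        rfl
      · rw [hT₁v k h0, initTapes_of_ne]
        rw [Fin.forall_fin_two]
        exact ⟨Ne.symm h0, Ne.symm h1⟩)
  have hr₆ := Core.test_runs (a := ev outv) (w := V ![x, w])
    (T := Function.extend ev T₅ T₄) (by rw [ev.injective.extend_apply, ho₅])
  have hrun := Core.Runs.bind hr₁ (Core.Runs.bind hr₂' (Core.Runs.bind hr₃ (Core.Runs.bind hr₄
    (Core.Runs.bind hr₅' (D := fun _ => Core.test (ev outv)) hr₆) (D := fun _ =>
      (Cv.embed ev).bind fun _ => Core.test (ev outv))) (D := fun _ =>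
    (Core.rewind (ev (inpv 1)) {ev (inpv 1)}).bind fun _ =>
      (Cv.embed ev).bind fun _ => Core.test (ev outv))) (D := fun _ =>
    (Core.guessing (eq outq) (ev (inpv 1))).bind fun _ =>
      (Core.rewind (ev (inpv 1)) {ev (inpv 1)}).bind fun _ =>
        (Cv.embed ev).bind fun _ => Core.test (ev outv))) (D := fun _ =>
    (Cq.embed eq).bind fun _ => (Core.guessing (eq outq) (ev (inpv 1))).bind fun _ =>
      (Core.rewind (ev (inpv 1)) {ev (inpv 1)}).bind fun _ =>
        (Cv.embed ev).bind fun _ => Core.test (ev outv))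
  simp only [List.nil_append, List.append_nil] at hrun
  obtain ⟨c, hs, hc, -⟩ := Core.toNTM_steps inp none hrun
  refine ⟨_, ?_, c, _, hs, hc, by simp⟩
  have hlq' := hlq fun _ => x
  simp only [size, Fin.sum_univ_one, List.length_replicate] at hlq' hn₂
  have hsz : size ![x, w] = x.length + w.length := by simp [size, Fin.sum_univ_two]
  have hn₅' : n₅ ≤ rv.eval (x.length + rq.eval x.length) := by
    refine hn₅.trans (eval_mono rv ?_)
    omega
  simp only [Polynomial.eval_add, Polynomial.eval_mul, Polynomial.eval_ofNat, Polynomial.eval_X,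
    Polynomial.eval_comp]
  omega

end CLU

namespace CLU

/-! ### The lexicographical order on strings of a given length -/

/-- The number with a given binary representation. -/
def val : List Bool → ℕ
  | [] => 0
  | b :: w => b.toNat * 2 ^ w.length + val w

theorem val_lt : ∀ w : List Bool, val w < 2 ^ w.length
  | [] => by simp [val]
  | b :: w => by
    have := val_lt w
    cases b <;> simp [val, pow_succ] <;> omega

theorem val_append : ∀ s w : List Bool, val (s ++ w) = val s * 2 ^ w.length + val w
  | [], w => by simp [val]
  | b :: s, w => by
    simp only [List.cons_append, val, val_append s w, List.length_append, pow_add]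
    ring

theorem val_injective : ∀ {u w : List Bool}, u.length = w.length → val u = val w → u = w
  | [], [], _, _ => rfl
  | a :: u, b :: w, h, hv => by
    have hl : u.length = w.length := by simpa using h
    have h1 := val_lt u
    have h2 := val_lt w
    simp only [val] at hv
    rw [hl] at hv h1
    have : a = b ∧ val u = val w := by
      cases a <;> cases b <;> simp at hv ⊢ <;> omega
    rw [this.1, val_injective hl this.2]

theorem exists_val : ∀ (n m : ℕ), m < 2 ^ n → ∃ w ∈ strings n, val w = m
  | 0, m, h => ⟨[], rfl, by simp at h; simp [val, h]⟩
  | n + 1, m, h => by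
    rw [pow_succ] at h
    by_cases hm : m < 2 ^ n
    · obtain ⟨w, hw, rfl⟩ := exists_val n m hm
      exact ⟨false :: w, by simpa [strings] using hw, by simp [val]⟩
    · obtain ⟨w, hw, hv⟩ := exists_val n (m - 2 ^ n) (by omega)
      refine ⟨true :: w, by simpa [strings] using hw, ?_⟩
      have hw' : w.length = n := hw
      simp only [val, Bool.toNat_true, hw', hv]
      omega

theorem lexLT_iff : ∀ {u w : List Bool}, u.length = w.length → (lexLT u w ↔ val u < val w)
  | [], [], _ => by simp [lexLT, val]
  | a :: u, b :: w, h => by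
    have hl : u.length = w.length := by simpa using h
    have ih := lexLT_iff hl
    have h1 := val_lt u
    have h2 := val_lt w
    rw [lexLT, List.shortlex_iff_lex hl] at ih
    rw [lexLT, List.shortlex_iff_lex h, List.cons_lex_cons_iff, ih]
    simp only [val]
    rw [hl] at h1 ⊢
    cases a <;> cases b <;> simp [Bool.lt_iff] <;> omega

theorem lexLE_iff {u w : List Bool} (h : u.length = w.length) : lexLE u w ↔ val u ≤ val w := by
  rw [lexLE, lexLT_iff h, le_iff_eq_or_lt]
  exact or_congr_left ⟨fun h => h ▸ rfl, val_injective h⟩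

/-- On strings of equal length the order is that of the binary values, and these run through all
numbers below `2 ^ n`. -/
theorem lexSucc_iff {u w : List Bool} (h : u.length = w.length) :
    lexSucc u w ↔ val w = val u + 1 := by
  rw [lexSucc, lexLT_iff h]
  constructor
  · rintro ⟨h1, h2⟩
    by_contra hne
    have := val_lt w
    obtain ⟨c, hc, hv⟩ := exists_val w.length (val u + 1) (by omega)
    have hc' : c.length = w.length := hc
    refine h2 c ⟨(lexLT_iff (h.trans hc'.symm)).2 (by omega), (lexLT_iff hc').2 (by omega)⟩
  · intro hv
    refine ⟨by omega, fun c ⟨h1, h2⟩ => ?_⟩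
    -- The order is length-first, so anything between two strings of equal length has that length
    -- too.
    have hc : c.length = w.length := by
      rw [lexLT, List.shortlex_def] at h1 h2
      omega
    rw [lexLT_iff (h.trans hc.symm)] at h1
    rw [lexLT_iff hc] at h2
    omega

theorem val_replicate_false : ∀ n, val (List.replicate n false) = 0
  | 0 => rfl
  | n + 1 => by simp [List.replicate_succ, val, val_replicate_false n]

theorem val_replicate_true : ∀ n, val (List.replicate n true) + 1 = 2 ^ n
  | 0 => rfl
  | n + 1 => by
    simp only [List.replicate_succ, val, List.length_replicate, pow_succ, Bool.toNat_true,
      add_assoc, val_replicate_true n]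
    ring

theorem eq_replicate_false_iff {w : List Bool} {n : ℕ} (hw : w.length = n) :
    w = List.replicate n false ↔ val w = 0 :=
  ⟨fun h => h ▸ val_replicate_false n, fun h =>
    val_injective (by simp [hw]) (by rw [h, val_replicate_false])⟩

theorem eq_replicate_true_iff {w : List Bool} {n : ℕ} (hw : w.length = n) :
    w = List.replicate n true ↔ val w + 1 = 2 ^ n :=
  ⟨fun h => h ▸ val_replicate_true n, fun h =>
    val_injective (by simp [hw]) (by have := val_replicate_true n; omega)⟩

/-- Addition of one with carry: the low parts are below `2 ^ n`, so either the high part is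
unchanged, or it grows by one and the low part goes from `2 ^ n - 1` to `0`. -/
theorem lexSucc_append {s t u w : List Bool} {n : ℕ} (hst : s.length = t.length)
    (hu : u.length = n) (hw : w.length = n) : lexSucc (s ++ u) (t ++ w) ↔
      s = t ∧ lexSucc u w ∨
      lexSucc s t ∧ u = List.replicate n true ∧ w = List.replicate n false := by
  rw [lexSucc_iff (by simp [hst, hu, hw]), lexSucc_iff (hu.trans hw.symm), lexSucc_iff hst,
    val_append, val_append, hu, hw, eq_replicate_true_iff hu, eq_replicate_false_iff hw]
  have h1 := val_lt u
  have h2 := val_lt w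
  rw [hu] at h1
  rw [hw] at h2
  constructor
  · intro h
    rcases lt_trichotomy (val t) (val s) with hlt | heq | hgt
    · nlinarith
    · rw [heq] at h
      exact Or.inl ⟨val_injective hst heq.symm, by omega⟩
    · right
      obtain ⟨d, hd⟩ := Nat.exists_eq_add_of_lt hgt
      have hd0 : d = 0 := by
        by_contra hd0
        have : 1 ≤ d := by omega
        rw [hd] at h
        nlinarith
      subst hd0
      rw [hd, add_mul, add_mul] at h
      omega
  · rintro (⟨rfl, h⟩ | ⟨h, h', h''⟩)
    · omega
    · rw [h, h'', add_mul]
      omega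

/-- The automaton that checks whether two strings are adjacent. -/
def succStep : Bool → Bool → Bool → Option Bool
  | false, a, b => if a = b then some false else if b then some true else none
  | true, a, b => if a && !b then some true else none

/-- State `true` means that the digit which turns from zero to one has been read; the rest must then
be all ones in `u` and all zeros in `w`. The equation says just this, as values are below `2 ^
u.length`. -/
theorem pairEval_succStep_true : ∀ {u w : List Bool}, u.length = w.length →
    (pairEval succStep id true u w = true ↔ val u + 1 = val w + 2 ^ u.length)
  | [], [], _ => by simp [pairEval, val]
  | a :: u, b :: w, h => by
    have hl : u.length = w.length := by simpa using h
    have ih := pairEval_succStep_true hl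
    have h1 := val_lt u
    have h2 := val_lt w
    rw [hl] at h1 ih
    cases a <;> cases b <;> simp [pairEval, succStep, val, hl, pow_succ, ih] <;> omega

theorem pairEval_succStep : ∀ {u w : List Bool}, u.length = w.length →
    (pairEval succStep id false u w = true ↔ lexSucc u w)
  | [], [], _ => by simp [lexSucc_iff, pairEval, val]
  | a :: u, b :: w, h => by
    have hl : u.length = w.length := by simpa using h
    have ih := pairEval_succStep hl
    rw [lexSucc_iff hl] at ih
    rw [lexSucc_iff h]
    have h1 := val_lt u
    have h2 := val_lt w
    have h3 := pairEval_succStep_true hl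
    rw [hl] at h1 h3
    cases a <;> cases b <;> simp [pairEval, succStep, val, hl, ih, h3] <;> omega

/-- The automaton that checks whether two strings are equal. -/
def eqStep (_ : Unit) (a b : Bool) : Option Unit := if a = b then some () else none

theorem pairEval_eqStep : ∀ u w : List Bool, pairEval eqStep (fun _ => true) () u w = true ↔ u = w
  | [], [] => by simp [pairEval]
  | [], _ :: _ => by simp [pairEval]
  | _ :: _, [] => by simp [pairEval]
  | a :: u, b :: w => by
    have ih := pairEval_eqStep u w
    by_cases h : a = b <;> simp [pairEval, eqStep, h]
    exact ih

/-! ### Inserting an order into the lexicographical order -/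

/-- Strings `y ++ s`, where `|y| = n`, are ordered lexicographically with `s` as the more significant
part, except that for `s = s₀`, the order of the strings `y` is determined by `h`. -/
def twist (n : ℕ) (h : List Bool → List Bool) (s₀ v : List Bool) : List Bool :=
  v.drop n ++ if v.drop n = s₀ then h (v.take n) else v.take n

section twist

variable {n k : ℕ} {h : List Bool → List Bool} {s₀ : List Bool}

theorem twist_append {y : List Bool} (hy : y ∈ strings n) (s : List Bool) :
    twist n h s₀ (y ++ s) = s ++ if s = s₀ then h y else y := by
  have hy' : y.length = n := hy
  subst hy'
  simp [twist]

theorem mem_strings_add {v : List Bool} :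
    v ∈ strings (n + k) ↔ ∃ y ∈ strings n, ∃ s ∈ strings k, v = y ++ s := by
  constructor
  · intro hv
    have hv' : v.length = n + k := hv
    exact ⟨v.take n, by simp [strings, hv'], v.drop n, by simp [strings, hv'], by simp⟩
  · rintro ⟨y, hy, s, hs, rfl⟩
    have hy' : y.length = n := hy
    have hs' : s.length = k := hs
    simp [strings, hy', hs']

theorem ite_mem_strings (hh : Set.MapsTo h (strings n) (strings n)) {s y : List Bool}
    (hy : y ∈ strings n) : (if s = s₀ then h y else y) ∈ strings n := by
  split
  · exact hh hy
  · exact hy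

theorem twist_bijOn (hh : Set.BijOn h (strings n) (strings n)) :
    Set.BijOn (twist n h s₀) (strings (n + k)) (strings (n + k)) := by
  refine ⟨?_, ?_, ?_⟩
  · intro v hv
    obtain ⟨y, hy, s, hs, rfl⟩ := mem_strings_add.1 hv
    rw [twist_append hy, add_comm]
    exact mem_strings_add.2 ⟨s, hs, _, ite_mem_strings hh.mapsTo hy, rfl⟩
  · intro v hv v' hv' heq
    obtain ⟨y, hy, s, hs, rfl⟩ := mem_strings_add.1 hv
    obtain ⟨y', hy', s', hs', rfl⟩ := mem_strings_add.1 hv'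
    rw [twist_append hy, twist_append hy'] at heq
    obtain ⟨rfl, heq⟩ := List.append_inj heq (hs.trans hs'.symm)
    split at heq
    · rw [hh.injOn hy hy' heq]
    · rw [heq]
  · intro z hz
    rw [add_comm] at hz
    obtain ⟨s, hs, a, ha, rfl⟩ := mem_strings_add.1 hz
    by_cases hss : s = s₀
    · obtain ⟨y, hy, rfl⟩ := hh.surjOn ha
      exact ⟨y ++ s, mem_strings_add.2 ⟨y, hy, s, hs, rfl⟩, by rw [twist_append hy, if_pos hss]⟩
    · exact ⟨a ++ s, mem_strings_add.2 ⟨a, ha, s, hs, rfl⟩, by rw [twist_append ha, if_neg hss]⟩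

/-- The block of a constant `s` is an ordinary one. This is what makes the new bottom and top
trivial to compute. -/
theorem twist_replicate {b : Bool} (hs₀ : s₀ ≠ List.replicate k b) :
    twist n h s₀ (List.replicate (n + k) b) = List.replicate (n + k) b := by
  rw [← List.replicate_append_replicate, twist_append (by simp [strings]), if_neg hs₀.symm,
    List.replicate_append_replicate, List.replicate_append_replicate, add_comm]

/-- Across blocks, `h` matters only through the preimages of the strings of zeros and of ones, which
are `b` and `t`; within the special block, only through adjacency. So the right-hand side can be
decided without `h`. -/
theorem lexSucc_twist (hh : Set.BijOn h (strings n) (strings n)) {b t : List Bool}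
    (hb : b ∈ strings n) (ht : t ∈ strings n) (hhb : h b = List.replicate n false)
    (hht : h t = List.replicate n true) {y y' s s' : List Bool} (hy : y ∈ strings n)
    (hy' : y' ∈ strings n) (hs : s ∈ strings k) (hs' : s' ∈ strings k) :
    lexSucc (twist n h s₀ (y ++ s)) (twist n h s₀ (y' ++ s')) ↔
      (s = s' ∧ if s = s₀ then lexSucc (h y) (h y') else lexSucc y y') ∨
      lexSucc s s' ∧ (y = if s = s₀ then t else List.replicate n true) ∧
        y' = if s' = s₀ then b else List.replicate n false := by
  rw [twist_append hy, twist_append hy', lexSucc_append (hs.trans hs'.symm)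
    (ite_mem_strings hh.mapsTo hy) (ite_mem_strings hh.mapsTo hy')]
  have h1 : (if s = s₀ then h y else y) = List.replicate n true ↔
      y = if s = s₀ then t else List.replicate n true := by
    split
    · rw [← hht]; exact hh.injOn.eq_iff hy ht
    · rfl
  have h2 : (if s' = s₀ then h y' else y') = List.replicate n false ↔
      y' = if s' = s₀ then b else List.replicate n false := by
    split
    · rw [← hhb]; exact hh.injOn.eq_iff hy' hb
    · rfl
  rw [h1, h2]
  refine or_congr_left (and_congr_right ?_)
  rintro rfl
  split <;> rfl

/-- A string between two strings of the block `s₀` has the same more significant part, hence lies in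
that block, where the order is that of `h`. -/
theorem twist_interval (hh : Set.BijOn h (strings n) (strings n)) (hs₀ : s₀ ∈ strings k)
    {l u : List Bool} (hl : l ∈ strings n) (hu : u ∈ strings n) :
    {w | w ∈ strings (n + k) ∧ lexLE (twist n h s₀ (l ++ s₀)) (twist n h s₀ w) ∧
      lexLE (twist n h s₀ w) (twist n h s₀ (u ++ s₀))} =
    (fun y => y ++ s₀) '' {y | y ∈ strings n ∧ lexLE (h l) (h y) ∧ lexLE (h y) (h u)} := by
  have hlen : ∀ {y}, y ∈ strings n → (h y).length = n := fun hy => hh.mapsTo hy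
  have key : ∀ {y s}, y ∈ strings n → s ∈ strings k →
      val (twist n h s₀ (y ++ s)) = val s * 2 ^ n + val (if s = s₀ then h y else y) ∧
      val (if s = s₀ then h y else y) < 2 ^ n ∧ (twist n h s₀ (y ++ s)).length = k + n := by
    intro y s hy hs
    have h1 : (if s = s₀ then h y else y).length = n := ite_mem_strings hh.mapsTo hy
    have h2 : s.length = k := hs
    have h3 := val_lt (if s = s₀ then h y else y)
    rw [twist_append hy, val_append, List.length_append, h1, h2]
    rw [h1] at h3
    exact ⟨rfl, h3, rfl⟩
  have hle : ∀ {y z s t}, y ∈ strings n → z ∈ strings n → s ∈ strings k → t ∈ strings k →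
      lexLE (twist n h s₀ (y ++ s)) (twist n h s₀ (z ++ t)) →
      val s ≤ val t := by
    intro y z s t hy hz hs ht hle
    obtain ⟨e1, b1, l1⟩ := key hy hs
    obtain ⟨e2, b2, l2⟩ := key hz ht
    rw [lexLE_iff (l1.trans l2.symm), e1, e2] at hle
    by_contra hlt
    nlinarith
  have hiff : ∀ {y z}, y ∈ strings n → z ∈ strings n →
      (lexLE (twist n h s₀ (y ++ s₀)) (twist n h s₀ (z ++ s₀)) ↔ lexLE (h y) (h z)) := by
    intro y z hy hz
    obtain ⟨e1, -, l1⟩ := key hy hs₀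
    obtain ⟨e2, -, l2⟩ := key hz hs₀
    rw [lexLE_iff (l1.trans l2.symm), e1, e2, lexLE_iff ((hlen hy).trans (hlen hz).symm)]
    simp
  ext w
  constructor
  · rintro ⟨hw, h1, h2⟩
    obtain ⟨y, hy, s, hs, rfl⟩ := mem_strings_add.1 hw
    obtain rfl : s = s₀ := val_injective (hs.trans hs₀.symm)
      (le_antisymm (hle hy hu hs hs₀ h2) (hle hl hy hs₀ hs h1))
    exact ⟨y, ⟨hy, (hiff hl hy).1 h1, (hiff hy hu).1 h2⟩, rfl⟩
  · rintro ⟨y, ⟨hy, h1, h2⟩, rfl⟩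
    exact ⟨mem_strings_add.2 ⟨y, hy, s₀, hs₀, rfl⟩, (hiff hl hy).2 h1, (hiff hy hu).2 h2⟩

end twist

end CLU

namespace CLU

/-! ### Polynomial-time decidable predicates -/

open Classical in
/-- `A` is decidable in polynomial time. -/
def FPred {k : ℕ} (A : (Fin k → List Bool) → Prop) : Prop := FP fun v => if A v then [true] else []

section FPred

variable {k : ℕ} {A B : (Fin k → List Bool) → Prop} {f g : (Fin k → List Bool) → List Bool}

open Classical in
theorem FPred.ite (hA : FPred A) (hf : FP f) (hg : FP g) :
    FP fun v => if A v then f v else g v := by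
  convert FP.ite hA hf hg using 2 with v
  by_cases h : A v <;> simp [h]

theorem FPred.and (hA : FPred A) (hB : FPred B) : FPred fun v => A v ∧ B v := by
  refine (congrArg FP (funext fun v => ?_)).mp (hA.ite hB FP.nil)
  by_cases h : A v
  · rw [if_pos h]
    by_cases h' : B v
    · rw [if_pos h']
      exact (if_pos ⟨h, h'⟩).symm
    · rw [if_neg h']
      exact (if_neg fun hn => h' hn.2).symm
  · rw [if_neg h]
    exact (if_neg fun hn => h hn.1).symm

theorem FPred.or (hA : FPred A) (hB : FPred B) : FPred fun v => A v ∨ B v := by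
  refine (congrArg FP (funext fun v => ?_)).mp (hA.ite (FP.singleton true) hB)
  by_cases h : A v
  · rw [if_pos h]
    exact (if_pos (.inl h)).symm
  · rw [if_neg h]
    by_cases h' : B v
    · rw [if_pos h']
      exact (if_pos (.inr h')).symm
    · rw [if_neg h']
      exact (if_neg fun hn => hn.elim h h').symm

open Classical in
theorem FPred.ite' {C : (Fin k → List Bool) → Prop} (hA : FPred A) (hB : FPred B) (hC : FPred C) :
    FPred fun v => if A v then B v else C v := by
  refine (congrArg FP (funext fun v => ?_)).mp (hA.ite hB hC)
  by_cases h : A v <;> simp [h]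

theorem FP.ne_nil (hf : FP f) : FPred fun v => f v ≠ [] := by
  refine (congrArg FP (funext fun v => ?_)).mp (hf.ite (FP.singleton true) FP.nil)
  by_cases h : f v = [] <;> simp [h]

theorem FP.eq (hf : FP f) (hg : FP g) : FPred fun v => f v = g v := by
  refine (congrArg FP (funext fun v => ?_)).mp (FP.pairEval eqStep (fun _ => true) () hf hg)
  simp only [pairEval_eqStep]
  congr

theorem FP.succ (hf : FP f) (hg : FP g) :
    FPred fun v => CLU.pairEval succStep id false (f v) (g v) = true := by
  refine (congrArg FP (funext fun v => ?_)).mp (FP.pairEval succStep id false hf hg)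
  congr

end FPred

/-! ### Padded strings -/

/-- The string consists of zeros, a one and an element of `A`. -/
def Padded (A : Set (List Bool)) (s : List Bool) : Prop :=
  s.dropWhile (!·) ≠ [] ∧ (s.dropWhile (!·)).drop 1 ∈ A

/-- The length and the part behind the first one determine a padded string; this gives uniqueness in
`exists_padded`. -/
theorem eq_of_dropWhile_ne_nil : ∀ {s : List Bool}, s.dropWhile (!·) ≠ [] →
    s = List.replicate (s.length - 1 - ((s.dropWhile (!·)).drop 1).length) false ++
      true :: (s.dropWhile (!·)).drop 1
  | [], h => by simp at h
  | true :: s, _ => by simp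
  | false :: s, h => by
    have h' : s.dropWhile (!·) ≠ [] := by simpa using h
    have hd : (false :: s).dropWhile (!·) = s.dropWhile (!·) := by simp
    have ih := eq_of_dropWhile_ne_nil h'
    have hlen : ((s.dropWhile (!·)).drop 1).length < s.length := by
      have h1 := (List.dropWhile_sublist (!·) (l := s)).length_le
      have h2 := List.length_pos_of_ne_nil h'
      rw [List.length_drop]
      omega
    rw [hd, show (false :: s).length - 1 - ((s.dropWhile (!·)).drop 1).length =
      (s.length - 1 - ((s.dropWhile (!·)).drop 1).length) + 1 by rw [List.length_cons]; omega,
      List.replicate_succ, List.cons_append, ← ih]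

/-- Two extra places leave room for the separating one and at least one zero before it, so that the
padded string is not constant. -/
theorem exists_padded {w : List Bool} {m : ℕ} (hw : w.length + 2 ≤ m) :
    ∃ s ∈ strings m, (∀ s' ∈ strings m, Padded {w} s' ↔ s' = s) ∧
      s ≠ List.replicate m false ∧ s ≠ List.replicate m true := by
  refine ⟨List.replicate (m - 1 - w.length) false ++ true :: w, ?_, fun s' hs' => ⟨?_, ?_⟩, ?_, ?_⟩
  · simp [strings]; omega
  · rintro ⟨h1, h2⟩
    have h3 := eq_of_dropWhile_ne_nil h1
    rwa [Set.mem_singleton_iff.1 h2, show s'.length = m from hs'] at h3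
  · rintro rfl
    simp [Padded]
  · intro h
    have : true ∈ List.replicate m false := by rw [← h]; simp
    simp at this
  · intro h
    have : false ∈ List.replicate m true := by
      rw [← h]
      simp
      omega
    simp at this

/-- The two halves of the string are padded elements of `A` and `B`. -/
def Padded₂ (A B : Set (List Bool)) (m : ℕ) (s : List Bool) : Prop :=
  Padded A (s.take m) ∧ Padded B (s.drop m)

theorem exists_padded₂ {w w' : List Bool} {m : ℕ} (hw : w.length + 2 ≤ m)
    (hw' : w'.length + 2 ≤ m) :
    ∃ s ∈ strings (m + m), (∀ s' ∈ strings (m + m), Padded₂ {w} {w'} m s' ↔ s' = s) ∧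
      ∀ b, s ≠ List.replicate (m + m) b := by
  obtain ⟨s₁, hs₁, h₁, h₁f, h₁t⟩ := exists_padded hw
  obtain ⟨s₂, hs₂, h₂, -, -⟩ := exists_padded hw'
  refine ⟨s₁ ++ s₂, mem_strings_add.2 ⟨s₁, hs₁, s₂, hs₂, rfl⟩, fun s' hs' => ?_, fun b hb => ?_⟩
  · obtain ⟨y, hy, z, hz, rfl⟩ := mem_strings_add.1 hs'
    have hy' : y.length = m := hy
    rw [Padded₂, List.take_left' hy', List.drop_left' hy', h₁ _ hy, h₂ _ hz]
    exact ⟨fun ⟨h, h'⟩ => by rw [h, h'], fun h => List.append_inj h (hy.trans hs₁.symm)⟩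
  · rw [← List.replicate_append_replicate] at hb
    have := (List.append_inj hb (by simpa [strings] using hs₁)).1
    cases b
    · exact h₁f this
    · exact h₁t this

/-! ### Replacing the functions in `UPSV_t` -/

theorem NTM.fpred_padded {M : NTM 1} (hM : M.PolyTime) {k : ℕ}
    {f g : (Fin k → List Bool) → List Bool} (hf : FP f) (hg : FP g) :
    FPred fun v => Padded (M.acc fun _ => f v) (g v) :=
  hg.strip.ne_nil.and (fp_accepts hM hf ((FP.singleton true).drop hg.strip))

/-- Totality rules out an empty set of accepting paths, so "at most one" becomes "exactly one". -/
theorem upsvt_spec {f : List Bool → List Bool} (hf : f ∈ UPSVt) : ∃ M : NTM 1, M.PolyTime ∧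
    (∀ x, ∃ w, M.acc (fun _ => x) = {w}) ∧
    ∀ x w c, M.Halts (fun _ => x) w c true → M.Outputs c (f x) := by
  obtain ⟨M, hM, h⟩ := hf
  refine ⟨M, hM, fun x => ?_, fun x w c hc => ?_⟩
  · obtain ⟨h1, -, h3⟩ := h x
    have hne : (M.acc fun _ => x).Nonempty := by
      by_contra hne
      exact h3 (Set.not_nonempty_iff_eq_empty.1 hne) trivial
    obtain ⟨w, hw⟩ := hne
    exact ⟨w, h1.eq_singleton_of_mem hw⟩
  · obtain ⟨s, hs, ho⟩ := (h x).2.1 w c hc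
    rw [PFun.coe_val, Part.mem_some_iff] at hs
    rwa [← hs]

open Classical in
/-- If `M` has a unique accepting path, then its output can be computed from a string that contains
this path in padded form. -/
theorem NTM.fp_unpad {M : NTM 1} (hM : M.PolyTime) {F : List Bool → List Bool}
    (hF : ∀ x w c, M.Halts (fun _ => x) w c true → M.Outputs c (F x)) {s : Polynomial ℕ}
    (hs : ∀ x, (F x).length ≤ s.eval x.length) {k : ℕ} {A : (Fin k → List Bool) → Prop}
    (hA : FPred A) {f g d : (Fin k → List Bool) → List Bool} (hf : FP f) (hg : FP g) (hd : FP d)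
    (h : ∀ v, A v → Padded (M.acc fun _ => f v) (g v)) :
    FP fun v => if A v then F (f v) else d v := by
  refine (congrArg FP (funext fun v => ?_)).mp
    (hA.ite (fp_output hM hF hs hf ((FP.singleton true).drop hg.strip)) hd)
  by_cases hv : A v
  · have := (h v hv).2
    simp only [hv, if_true]
    exact if_pos this
  · simp [hv]

/-! ### The new adjacency relation and the new accepting condition -/

section

variable (B T : NTM 1) (p : ℕ → ℕ) (r : Polynomial ℕ)

/-- `s` encodes the accepting paths of `B` and `T` on `x`. -/
def Special (x s : List Bool) : Prop :=
  Padded₂ (B.acc fun _ => x) (T.acc fun _ => x) (r.eval x.length) s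

open Classical in
/-- The adjacency relation of the order in which the order with adjacency relation `R` has been
inserted. -/
def insertedSucc (R : List Bool → List Bool → List Bool → Prop) (bot top : List Bool → List Bool)
    (x v v' : List Bool) : Prop :=
  (v.drop (p x.length) = v'.drop (p x.length) ∧
    if Special B T r x (v.drop (p x.length)) then R x (v.take (p x.length)) (v'.take (p x.length))
    else pairEval succStep id false (v.take (p x.length)) (v'.take (p x.length)) = true) ∨
  pairEval succStep id false (v.drop (p x.length)) (v'.drop (p x.length)) = true ∧
    v.take (p x.length) = (if Special B T r x (v.drop (p x.length)) then top x
      else List.replicate (p x.length) true) ∧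
    v'.take (p x.length) = if Special B T r x (v'.drop (p x.length)) then bot x
      else List.replicate (p x.length) false

variable {B T p r}

theorem fpred_special (hB : B.PolyTime) (hT : T.PolyTime) {k : ℕ}
    {f g : (Fin k → List Bool) → List Bool} (hf : FP f) (hg : FP g) :
    FPred fun v => Special B T r (f v) (g v) := by
  have hm := hf.poly r
  have h₁ := NTM.fpred_padded hB hf (hm.take hg)
  have h₂ := NTM.fpred_padded hT hf (hm.drop hg)
  simp only [List.length_replicate] at h₁ h₂
  exact h₁.and h₂

/-- The values `bot x` and `top x` are called for only under the condition that the block is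
special, and then the block's name contains the paths from which they can be computed. -/
theorem fpred_insertedSucc (hB : B.PolyTime) (hT : T.PolyTime)
    (hp : ∀ {k : ℕ} {f : (Fin k → List Bool) → List Bool}, FP f →
      FP fun v => List.replicate (p (f v).length) true)
    {R : List Bool → List Bool → List Bool → Prop} (hR : R ∈ PTimePred₃)
    {bot top : List Bool → List Bool} {s : Polynomial ℕ}
    (hbot : ∀ x w c, B.Halts (fun _ => x) w c true → B.Outputs c (bot x))
    (hbot' : ∀ x, (bot x).length ≤ s.eval x.length)
    (htop : ∀ x w c, T.Halts (fun _ => x) w c true → T.Outputs c (top x))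
    (htop' : ∀ x, (top x).length ≤ s.eval x.length) :
    FPred fun v : Fin 3 → List Bool => insertedSucc B T p r R bot top (v 0) (v 1) (v 2) := by
  have hx : FP fun v : Fin 3 → List Bool => v 0 := FP.proj 0
  have hn := hp hx
  have hs := hn.drop (FP.proj 1)
  have hs' := hn.drop (FP.proj 2)
  have hy := hn.take (FP.proj 1)
  have hy' := hn.take (FP.proj 2)
  have hz := hn.fill false
  simp only [List.length_replicate] at hs hs' hy hy' hz
  have hS := fpred_special (r := r) hB hT hx hs
  have hS' := fpred_special (r := r) hB hT hx hs'
  have hm := hx.poly r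
  have ht₁ := hm.drop hs
  have ht₂ := hm.take hs'
  simp only [List.length_replicate] at ht₁ ht₂
  -- The last element of the first string's block: `top x` from the path in the second half of `s`,
  -- with the string of ones as default.
  have hl := NTM.fp_unpad hT htop htop' hS hx ht₁ hn fun v hv => hv.2
  -- The first element of the second string's block: `bot x` from the path in the first half of
  -- `s'`, with the string of zeros as default.
  have hf := NTM.fp_unpad hB hbot hbot' hS' hx ht₂ hz fun v hv => hv.1
  exact ((hs.eq hs').and (hS.ite' (fp_of_pTimePred₃ hR hx hy hy') (hy.succ hy'))).or
    ((hs.succ hs').and ((hy.eq hl).and (hy'.eq hf)))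

theorem fpred_insertedAcc (hB : B.PolyTime) (hT : T.PolyTime) {M : NTM 1} (hM : M.PolyTime)
    (hp : ∀ {k : ℕ} {f : (Fin k → List Bool) → List Bool}, FP f →
      FP fun v => List.replicate (p (f v).length) true) :
    FPred fun v : Fin 2 → List Bool => Special B T r (v 0) ((v 1).drop (p (v 0).length)) ∧
      (v 1).take (p (v 0).length) ∈ M.acc fun _ => v 0 := by
  have hx : FP fun v : Fin 2 → List Bool => v 0 := FP.proj 0
  have hn := hp hx
  have hs := hn.drop (FP.proj 1)
  have hy := hn.take (FP.proj 1)
  simp only [List.length_replicate] at hs hy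
  exact (fpred_special hB hT hx hs).and (NTM.fp_accepts hM hx hy)

end

/-! ### The main inclusion -/

theorem clu_upsvt_subset : CLUSharpPWith UPSVt ⊆ CLUSharpP := by
  classical
  rintro f ⟨p, ⟨P, hP⟩, M, hM, hMp, bot, hbot, top, htop, R, hR, hx⟩
  obtain ⟨B, hB, hBw, hBo⟩ := upsvt_spec hbot
  obtain ⟨T, hT, hTw, hTo⟩ := upsvt_spec htop
  obtain ⟨rB, hrB⟩ := id hB
  obtain ⟨rT, hrT⟩ := id hT
  obtain ⟨rM, hrM⟩ := id hM
  -- A path is no longer than its computation, so this bounds both accepting paths and leaves the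
  -- two places needed for padding.
  let r : Polynomial ℕ := rB + rT + 2
  let q : ℕ → ℕ := fun n => p n + (r.eval n + r.eval n)
  have hp : ∀ {k : ℕ} {f : (Fin k → List Bool) → List Bool}, FP f →
      FP fun v => List.replicate (p (f v).length) true := fun hf => NTM.fp_guesses hM hMp hf
  have hpM : ∀ x : List Bool, p x.length ≤ rM.eval x.length := by
    intro x
    have hmem : List.replicate (p x.length) true ∈ M.paths fun _ => x := by
      rw [hMp]; simp [strings]
    obtain ⟨c, b, ⟨n, hs⟩, -⟩ := hmem
    have h1 := hs.length_le
    have h2 := hrM _ _ _ _ hs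
    simp only [List.length_replicate, Fin.sum_univ_one] at h1 h2
    omega
  have hq : ∀ {k : ℕ} {f : (Fin k → List Bool) → List Bool}, FP f →
      FP fun v => List.replicate (q (f v).length) true := by
    intro k f hf
    have := (hp hf).append ((hf.poly r).append (hf.poly r))
    simpa only [List.replicate_append_replicate] using this
  obtain ⟨M', hM', hMq, hacc⟩ := exists_balanced (q := q) (hq (FP.proj 0))
    (fpred_insertedAcc (p := p) (r := r) hB hT hM hp)
  have hones : (fun x : List Bool => List.replicate (q x.length) true) ∈ FPt :=
    fpt_of_fp (hq (FP.proj (0 : Fin 1)))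
  have hzeros : (fun x : List Bool => List.replicate (q x.length) false) ∈ FPt := by
    have := fpt_of_fp ((hq (FP.proj (0 : Fin 1))).fill false)
    simpa only [List.length_replicate] using this
  -- The lengths of `bot x` and `top x` are `p(|x|)`, which is at most the time bound of `M`, a
  -- polynomial with natural coefficients.
  have hsucc := pTimePred₃_of_fp (fpred_insertedSucc (r := r) hB hT hp hR hBo
    (fun x => (hx x).choose_spec.2.1.1.trans_le (hpM x)) hTo
    (fun x => (hx x).choose_spec.2.1.2.trans_le (hpM x)))
  have hsucc' : insertedSucc B T p r R bot top ∈ PTimePred₃ := by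
    convert hsucc using 4 with x y z
    exact ⟨fun h => (if_pos h).trans_ne (by simp), fun h => by_contra fun hn => h (if_neg hn)⟩
  have hqP : IsPoly q := by
    refine ⟨P + 2 * r.map (Nat.castRingHom ℚ), fun n => ?_⟩
    simp only [q, Nat.cast_add, hP, Polynomial.eval_add, Polynomial.eval_mul,
      Polynomial.eval_ofNat, Polynomial.eval_natCast_map, eq_natCast,
      Nat.cast_id]
    ring
  refine ⟨q, hqP, M', hM', hMq, _, hzeros, _, hones, _, hsucc', fun x => ?_⟩
  obtain ⟨h, hh, ⟨hb, ht⟩, ⟨hhb, hht⟩, hadj, hint, hcard⟩ := hx x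
  obtain ⟨w₁, hw₁⟩ := hBw x
  obtain ⟨w₂, hw₂⟩ := hTw x
  have hlen : ∀ {A : NTM 1} {rA : Polynomial ℕ} {w : List Bool},
      (∀ (v : Fin 1 → List Bool) (w : List Bool) (n : ℕ) (c : A.Cfg),
        A.Steps (A.init v) w n c → n ≤ rA.eval (∑ i, (v i).length)) →
      A.acc (fun _ => x) = {w} → w.length ≤ rA.eval x.length := by
    intro A rA w hA hw
    obtain ⟨c, ⟨n, hs⟩, -⟩ : w ∈ A.acc fun _ => x := by rw [hw]; rfl
    have := hs.length_le.trans (hA _ _ _ _ hs)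
    simpa only [Fin.sum_univ_one] using this
  have hlB := hlen hrB hw₁
  have hlT := hlen hrT hw₂
  have hr : r.eval x.length = rB.eval x.length + rT.eval x.length + 2 := by simp [r]
  obtain ⟨s₀, hs₀, hsp, hne⟩ := exists_padded₂ (w := w₁) (w' := w₂) (m := r.eval x.length)
    (by omega) (by omega)
  -- The sets of accepting paths are singletons, so `s₀` is the only special string of its length.
  rw [← hw₁, ← hw₂] at hsp
  change ∀ s ∈ strings _, Special B T r x s ↔ s = s₀ at hsp
  have hacc' : M'.acc (fun _ => x) = (fun y => y ++ s₀) '' M.acc fun _ => x := by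
    have hsub : ∀ y ∈ M.acc (fun _ => x), y ∈ strings (p x.length) := by
      rintro y ⟨c, hc⟩
      rw [← hMp]
      exact ⟨c, true, hc⟩
    rw [hacc]
    ext w
    constructor
    · rintro ⟨hw, hV⟩
      obtain ⟨y, hy, s, hs, rfl⟩ := mem_strings_add.1 hw
      have hy' : y.length = p x.length := hy
      simp only [Matrix.cons_val_zero, Matrix.cons_val_one, List.drop_left' hy',
        List.take_left' hy', ne_eq, ite_eq_right_iff, reduceCtorEq, imp_false, not_not,
        hsp s hs] at hV
      exact ⟨y, hV.2, by rw [hV.1]⟩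
    · rintro ⟨y, hyM, rfl⟩
      have hy := hsub y hyM
      have hy' : y.length = p x.length := hy
      refine ⟨mem_strings_add.2 ⟨y, hy, s₀, hs₀, rfl⟩, ?_⟩
      simp only [Matrix.cons_val_zero, Matrix.cons_val_one, List.drop_left' hy',
        List.take_left' hy', ne_eq, ite_eq_right_iff, reduceCtorEq, imp_false, not_not,
        hsp s₀ hs₀]
      exact ⟨trivial, hyM⟩
  refine ⟨twist (p x.length) h s₀, twist_bijOn hh, by simp,
    ⟨twist_replicate (hne false), twist_replicate (hne true)⟩, ?_, ?_, ?_⟩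
  · intro v hv v' hv'
    obtain ⟨y, hy, s, hs, rfl⟩ := mem_strings_add.1 hv
    obtain ⟨y', hy', s', hs', rfl⟩ := mem_strings_add.1 hv'
    have hl : y.length = p x.length := hy
    have hl' : y'.length = p x.length := hy'
    rw [lexSucc_twist hh hb ht hhb hht hy hy' hs hs']
    -- With `s = s₀` for `Special`, lexicographical adjacency for the automaton and `h` for `R`, the
    -- new predicate is literally the criterion of `lexSucc_twist`.
    simp only [insertedSucc, List.drop_left' hl, List.drop_left' hl', List.take_left' hl,
      List.take_left' hl', hsp s hs, hsp s' hs', pairEval_succStep (hl.trans hl'.symm),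
      pairEval_succStep (hs.trans hs'.symm), hadj y hy y' hy']
  · intro hf
    obtain ⟨l, hl, u, hu, hlu⟩ := hint hf
    refine ⟨l ++ s₀, mem_strings_add.2 ⟨l, hl, s₀, hs₀, rfl⟩, u ++ s₀,
      mem_strings_add.2 ⟨u, hu, s₀, hs₀, rfl⟩, ?_⟩
    rw [hacc', hlu, ← twist_interval hh hs₀ hl hu]
  · rw [hcard, hacc', Set.ncard_image_of_injective _ fun a b hab => by simpa using hab]

theorem cluSharpPWith_mono {F G : Set (List Bool → List Bool)} (h : F ⊆ G) :
    CLUSharpPWith F ⊆ CLUSharpPWith G := by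
  rintro f ⟨p, hp, M, hM, hMp, bot, hbot, top, htop, h'⟩
  exact ⟨p, hp, M, hM, hMp, bot, h hbot, top, h htop, h'⟩

end CLU

/-- If, in the definition of `CLU#P`, the bottom and top functions are taken from `UPSV_t` instead
of `FP_t`, the class so defined is still precisely `CLU#P`. -/
theorem corollaryc : CLU.CLUSharpPWith CLU.UPSVt = CLU.CLUSharpP :=
  Set.Subset.antisymm CLU.clu_upsvt_subset (CLU.cluSharpPWith_mono CLU.fpt_subset_upsvt)
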